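/- SAM with step size $\eta$ and neighborhood size $\rho$ on a loss $\ell:\mathbb R^d\to\mathbb R$ is the iteration $$w_{t+1}=w_t-\eta\,\nabla\ell\!\left(w_t+\rho\,\frac{\nabla\ell(w_t)}{\|\nabla\ell(w_t)\|}\right),\qquad t=0,1,2,\dots$$ ($\|\cdot\|$ is the Euclidean norm). **Theorem.** There is a univariate real polynomial $p$ such that for every dimension $d\ge 2$ there is a real polynomial $p'$ in eight variables, positive whenever all of its arguments are positive, such that the following holds. Let $\lambda_1>\lambda_2\ge\dots\ge\lambda_d>0$, $\ell(w)=\frac12 w^\top\Lambda w$ with $\Lambda=\mathrm{diag}(\lambda_1,\dots,\lambda_d)$, $\kappa=\lambda_1/\lambda_d$, $\rho>0$, $0<\eta<\frac1{2\lambda_1}$, $\delta>0$, $q>0$, $A\in\mathbb R$ and $R>\eta\rho\lambda_1$. Let $w_0$ be drawn from a probability distribution on $\mathbb R^d$ that has a density (with respect to Lebesgue measure) bounded above by $A$, and suppose that with probability at least $1-\delta$ we have both $\|w_0\|\le R$ and $w_{0,1}^2\ge q$, where $w_{0,1}$ is the first coordinate of $w_0$. Let $w_1,w_2,\dots$ be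 the SAM iterates on $\ell$ started at $w_0$. Then, for every $\epsilon$ with $$0<\epsilon<p'\!\left(\tfrac1{\lambda_1},\lambda_d,\eta,\rho,\delta,\tfrac1\rho,\tfrac1A,\tfrac1R\right),$$ with probability at least $1-2\delta$, for all integers $t\ge 0$ with $$t\ \ge\ \left(\frac{\kappa^5}{\eta\lambda_d\,\min\{\eta\lambda_d,\ \lambda_1^2/\lambda_2^2-1\}}+d\right)p\!\left(\log\frac1\epsilon\right),$$ one of the following holds: * $\left\|w_t-\frac{\eta\rho\lambda_1e_1}{2-\eta\lambda_1}\right\|\le\epsilon$ and $\left\|w_{t+1}+\frac{\eta\rho\lambda_1e_1}{2-\eta\lambda_1}\right\|\le\epsilon$, or * $\left\|w_t+\frac{\eta\rho\lambda_1e_1}{2-\eta\lambda_1}\right\|\le\epsilon$ and $\left\|w_{t+1}-\frac{\eta\rho\lambda_1e_1}{2-\eta\lambda_1}\right\|\le\epsilon$, where $e_1$ is the first standard basis vector. -/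

import Mathlib

open MeasureTheory

noncomputable section

/-- The convex quadratic loss `w ↦ ½ wᵀ Λ w` with `Λ = diag(lam)`. -/
def quadLoss {d : ℕ} (lam : Fin d → ℝ) (w : EuclideanSpace ℝ (Fin d)) : ℝ :=
  (1 / 2) * (w.ofLp ⬝ᵥ Matrix.mulVec (Matrix.diagonal lam) w.ofLp)

/-- One step of Sharpness-Aware Minimization on the loss `l`, with step size `η` and
neighborhood size `ρ`:  `w ↦ w - η ∇l(w + ρ ∇l(w) / ‖∇l(w)‖)`. -/
def samStep {d : ℕ} (l : EuclideanSpace ℝ (Fin d) → ℝ) (η ρ : ℝ)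
    (w : EuclideanSpace ℝ (Fin d)) : EuclideanSpace ℝ (Fin d) :=
  w - η • gradient l (w + (ρ / ‖gradient l w‖) • gradient l w)

/-- The SAM iterates `w₀, w₁, w₂, …` started at `w₀`. -/
def samIter {d : ℕ} (l : EuclideanSpace ℝ (Fin d) → ℝ) (η ρ : ℝ)
    (w₀ : EuclideanSpace ℝ (Fin d)) : ℕ → EuclideanSpace ℝ (Fin d)
  | 0 => w₀
  | t + 1 => samStep l η ρ (samIter l η ρ w₀ t)

/-- `μ` has a density with respect to Lebesgue measure, and the density is at most `A`. -/
def HasDensityAtMost {d : ℕ} (μ : Measure (EuclideanSpace ℝ (Fin d))) (A : ℝ) : Prop :=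
  ∃ f : EuclideanSpace ℝ (Fin d) → ENNReal,
    Measurable f ∧ (∀ x, f x ≤ ENNReal.ofReal A) ∧ μ = volume.withDensity f

/-- The endpoint `(η ρ λ₁ / (2 - η λ₁)) e₁` of the limiting two-cycle (the indices `0`, `1`, …
stand for the coordinates `1`, `2`, …). -/
def cyclePoint {n : ℕ} (lam : Fin (n + 2) → ℝ) (η ρ : ℝ) : EuclideanSpace ℝ (Fin (n + 2)) :=
  (η * ρ * lam 0 / (2 - η * lam 0)) • EuclideanSpace.single (0 : Fin (n + 2)) (1 : ℝ)

/-- The factor `κ⁵ / (η λ_d min{η λ_d, λ₁²/λ₂² - 1}) + d`, with `κ = λ₁/λ_d` and `d = n + 2`. -/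
def timeFactor {n : ℕ} (lam : Fin (n + 2) → ℝ) (η : ℝ) : ℝ :=
  (lam 0 / lam (Fin.last (n + 1))) ^ 5 /
      (η * lam (Fin.last (n + 1)) *
        min (η * lam (Fin.last (n + 1))) (lam 0 ^ 2 / lam 1 ^ 2 - 1))
    + ((n + 2 : ℕ) : ℝ)

end

/-! In the coordinates u_i = λ_i w_i / (ηρλ₁²), and up to the sign (-1)^t, SAM multiplies u_i by
l_i²/‖u‖ - (1 - e l_i). The two-cycle becomes the pair of fixed points ±e₁/(2 - e). Write h = eL =
ηλ_d and x = log(1/ε).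

Entry. The norm shrinks geometrically until it is at most 1, within about x/h steps, and stays there
(`norm_iterate_le`). On the way the leading factor 1/‖u‖ - (1 - e) may vanish, namely at ‖u‖ = 1/(1
- e), and the leading coordinate would be lost. Above a slightly larger threshold the map shrinks
distances by at most a constant factor (`samMap_antilipschitz`), so the initial points that arrive
from there close to the bad sphere fill little volume, and the bounded density makes them improbable
(`measure_exceptional_le`). One step from below the threshold takes the orbit past the bad sphere
for good (`norm_samMap_le_of_lt`).

Alignment. The map is a preconditioned gradient step for ½uᵀCu - ‖u‖ with C = diag((2 - e
l_i)/l_i²), and it decreases this function (`excess_samMap_le`). The ratios of the other coordinates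
to the leading one contract by 1 - r unless the norm noticeably overshoots 1/(2 - e). An overshoot s
can enlarge them by exp(O(s log(1/e))), but it also lowers the logarithm of the excess by an amount
proportional to s. Hence the ratio times a power of the truncated excess always contracts
(`abs_growth_le_exp_mul`), and the truncated excess has a bounded logarithmic range.

Convergence. Once the other coordinates are negligible, the leading one follows an affine
contraction of factor 1 - e about 1/(2 - e) (`leading_error_step`). The tolerance bound makes x
dominate the dimension and the logarithms of all parameters. A cubic in x suffices because the
leading coordinate at entry is at least exp(-O(x³/h)). -/

/-- The parameters of SAM on a quadratic after rescaling: `l i = λᵢ / λ₁`, `e = η λ₁`, `L` is a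
lower bound of the `l i` and `r` is a contraction rate. -/
structure NormalizedSpectrum {n : ℕ} (l : Fin (n + 2) → ℝ) (e L r : ℝ) : Prop where
  one : l 0 = 1
  lower : ∀ i, L ≤ l i
  le_one : ∀ i, l i ≤ 1
  pos : 0 < L
  e_pos : 0 < e
  e_lt : e < 1 / 2
  rate_pos : 0 < r
  rate_le : r ≤ e * L / 2
  gap : ∀ i, i ≠ 0 → l i ^ 2 ≤ 1 - r

/-- The factor by which the `i`-th coordinate is multiplied when the norm is `a`. -/
noncomputable def growth {n : ℕ} (l : Fin (n + 2) → ℝ) (e : ℝ) (i : Fin (n + 2)) (a : ℝ) : ℝ :=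
  l i ^ 2 / a - (1 - e * l i)

/-- The SAM step in rescaled gradient coordinates, up to an alternating sign. -/
noncomputable def samMap {n : ℕ} (l : Fin (n + 2) → ℝ) (e : ℝ)
    (u : EuclideanSpace ℝ (Fin (n + 2))) : EuclideanSpace ℝ (Fin (n + 2)) :=
  WithLp.toLp 2 fun i => u i * growth l e i ‖u‖

/-! ### Norm comparisons in Euclidean space. -/

section Coordinates

variable {ι : Type*} [Fintype ι]

theorem norm_le_mul_of_forall_abs_le {u v : EuclideanSpace ℝ ι} {B : ℝ} (hB : 0 ≤ B)
    (h : ∀ i, |v i| ≤ B * |u i|) : ‖v‖ ≤ B * ‖u‖ := by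
  refine le_of_sq_le_sq ?_ (by positivity)
  rw [mul_pow, EuclideanSpace.real_norm_sq_eq, EuclideanSpace.real_norm_sq_eq, Finset.mul_sum]
  refine Finset.sum_le_sum fun i _ => ?_
  rw [← sq_abs (v i), ← sq_abs (u i), ← mul_pow]
  exact pow_le_pow_left₀ (abs_nonneg _) (h i) 2

theorem mul_norm_le_of_forall_le_abs {u v : EuclideanSpace ℝ ι} {c : ℝ} (hc : 0 ≤ c)
    (h : ∀ i, c * |u i| ≤ |v i|) : c * ‖u‖ ≤ ‖v‖ := by
  refine le_of_sq_le_sq ?_ (by positivity)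
  rw [mul_pow, EuclideanSpace.real_norm_sq_eq, EuclideanSpace.real_norm_sq_eq, Finset.mul_sum]
  refine Finset.sum_le_sum fun i _ => ?_
  rw [← sq_abs (v i), ← sq_abs (u i), ← mul_pow]
  exact pow_le_pow_left₀ (by positivity) (h i) 2

theorem abs_coord_le_norm (u : EuclideanSpace ℝ ι) (i : ι) : |u i| ≤ ‖u‖ := by
  simpa using PiLp.norm_apply_le u i

theorem inner_eq_sum_mul (u v : EuclideanSpace ℝ ι) : inner ℝ u v = ∑ i, u i * v i := by
  rw [PiLp.inner_apply]
  refine Finset.sum_congr rfl fun i _ => ?_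
  simp [mul_comm]

end Coordinates

/-- A one-sided form of the fact that radial projection is `1 / θ`-Lipschitz outside the ball of
radius `θ`. The left side equals `(‖u‖⁻¹ + ‖v‖⁻¹) * (‖u‖ * ‖v‖ - ⟪u, v⟫)`, and `2 * (‖u‖ * ‖v‖ - ⟪u,
v⟫) ≤ ‖u - v‖ ^ 2`. -/
theorem inner_sub_sub_inv_norm_le {E : Type*} [NormedAddCommGroup E] [InnerProductSpace ℝ E]
    {u v : E} {θ : ℝ} (hθ : 0 < θ) (hu : θ ≤ ‖u‖) (hv : θ ≤ ‖v‖) :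
    inner ℝ (u - v) (‖u‖⁻¹ • u - ‖v‖⁻¹ • v) ≤ ‖u - v‖ ^ 2 / θ := by
  have ha : 0 < ‖u‖ := hθ.trans_le hu
  have hc : 0 < ‖v‖ := hθ.trans_le hv
  have hp : inner ℝ u v ≤ ‖u‖ * ‖v‖ := real_inner_le_norm u v
  have hsq := norm_sub_sq_real u v
  simp only [inner_sub_left, inner_sub_right, inner_smul_right, real_inner_self_eq_norm_sq,
    real_inner_comm u v]
  rw [hsq]
  set a := ‖u‖
  set c := ‖v‖
  set p := inner ℝ u v
  have h1 : a⁻¹ ≤ θ⁻¹ := inv_anti₀ hθ hu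
  have h2 : c⁻¹ ≤ θ⁻¹ := inv_anti₀ hθ hv
  have h3 : a⁻¹ * a ^ 2 - a⁻¹ * p - (c⁻¹ * p - c⁻¹ * c ^ 2) = (a⁻¹ + c⁻¹) * (a * c - p) := by
    field_simp
    ring
  have h4 : (a⁻¹ + c⁻¹) * (a * c - p) ≤ (2 * θ⁻¹) * (a * c - p) :=
    mul_le_mul_of_nonneg_right (by linarith) (by linarith)
  have h5 : (2 * θ⁻¹) * (a * c - p) ≤ (a ^ 2 - 2 * p + c ^ 2) / θ := by
    rw [div_eq_inv_mul]
    nlinarith [inv_pos.2 hθ, mul_nonneg (inv_pos.2 hθ).le (sq_nonneg (a - c))]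
  linarith [h3, h4, h5]

/-! ### Norm dynamics and the leading growth factor. -/

namespace NormalizedSpectrum

variable {n : ℕ} {l : Fin (n + 2) → ℝ} {e L r : ℝ}

theorem L_le_one (H : NormalizedSpectrum l e L r) : L ≤ 1 := H.one ▸ H.lower 0

theorem coord_pos (H : NormalizedSpectrum l e L r) (i : Fin (n + 2)) : 0 < l i :=
  H.pos.trans_le (H.lower i)

theorem mul_pos (H : NormalizedSpectrum l e L r) : 0 < e * L := _root_.mul_pos H.e_pos H.pos

theorem mul_le (H : NormalizedSpectrum l e L r) : e * L ≤ e := by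
  nlinarith [H.e_pos, H.L_le_one]

theorem two_mul_le (H : NormalizedSpectrum l e L r) : 2 * (e * L) ≤ L := by
  nlinarith [H.pos, H.e_lt]

theorem mul_lt_half (H : NormalizedSpectrum l e L r) : e * L < 1 / 2 := H.mul_le.trans_lt H.e_lt

@[simp] theorem samMap_apply (u : EuclideanSpace ℝ (Fin (n + 2))) (i : Fin (n + 2)) :
    samMap l e u i = u i * growth l e i ‖u‖ := rfl

@[simp] theorem samMap_zero : samMap l e (0 : EuclideanSpace ℝ (Fin (n + 2))) = 0 := by
  ext i; simp

theorem growth_zero (H : NormalizedSpectrum l e L r) (a : ℝ) :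
    growth l e 0 a = 1 / a - (1 - e) := by
  simp [growth, H.one]

/-- The quantity `l i ^ 2 - a * (1 - e * l i)` increases with `l i`, so its extremes occur at `l i =
1` and `l i = L`. -/
theorem norm_samMap_le_max (H : NormalizedSpectrum l e L r)
    {u : EuclideanSpace ℝ (Fin (n + 2))} (hu : u ≠ 0) :
    ‖samMap l e u‖ ≤ max (1 - ‖u‖ * (1 - e)) (‖u‖ * (1 - e * L) - L ^ 2) := by
  have ha : 0 < ‖u‖ := norm_pos_iff.2 hu
  set a := ‖u‖ with ha_def
  set B := max (1 - a * (1 - e)) (a * (1 - e * L) - L ^ 2) with hB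
  have key : ∀ i, |growth l e i a| ≤ B / a := fun i => by
    have hl := H.lower i
    have hl1 := H.le_one i
    have hp := H.pos
    have he := H.e_pos
    have e1 : growth l e i a = (l i ^ 2 - a * (1 - e * l i)) / a := by
      rw [growth]; field_simp
    rw [e1, abs_div, abs_of_pos ha]
    refine div_le_div_of_nonneg_right ?_ ha.le
    have h3 : a * e * L ≤ a * e * l i := mul_le_mul_of_nonneg_left hl (by positivity)
    have h4 : a * e * l i ≤ a * e * 1 := mul_le_mul_of_nonneg_left hl1 (by positivity)
    rw [abs_le']
    constructor
    · refine le_trans ?_ (le_max_left _ _)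
      nlinarith
    · refine le_trans ?_ (le_max_right _ _)
      nlinarith
  have hBn : 0 ≤ B / a := (abs_nonneg _).trans (key 0)
  have := norm_le_mul_of_forall_abs_le (v := samMap l e u) (u := u) hBn fun i => by
    rw [samMap_apply, abs_mul, mul_comm]
    exact mul_le_mul_of_nonneg_right (key i) (abs_nonneg _)
  rwa [div_mul_cancel₀ _ ha.ne'] at this

theorem norm_samMap_le (H : NormalizedSpectrum l e L r) (u : EuclideanSpace ℝ (Fin (n + 2))) :
    ‖samMap l e u‖ ≤ max 1 (‖u‖ * (1 - e * L) - L ^ 2) := by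
  rcases eq_or_ne u 0 with rfl | hu
  · simp
  · refine (H.norm_samMap_le_max hu).trans (max_le_max ?_ le_rfl)
    nlinarith [norm_nonneg u, H.e_lt]

theorem norm_samMap_le_one (H : NormalizedSpectrum l e L r)
    {u : EuclideanSpace ℝ (Fin (n + 2))} (hu : ‖u‖ ≤ 1) : ‖samMap l e u‖ ≤ 1 := by
  refine (H.norm_samMap_le u).trans (max_le le_rfl ?_)
  nlinarith [norm_nonneg u, H.mul_pos, H.mul_lt_half, sq_nonneg L]

theorem norm_iterate_le (H : NormalizedSpectrum l e L r) (u : EuclideanSpace ℝ (Fin (n + 2)))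
    (t : ℕ) : ‖(samMap l e)^[t] u‖ ≤ max 1 ((1 - e * L) ^ t * ‖u‖) := by
  induction t with
  | zero => simp
  | succ t ih =>
    rw [Function.iterate_succ_apply']
    refine (H.norm_samMap_le _).trans (max_le (le_max_left _ _) ?_)
    have h1 : 0 ≤ 1 - e * L := by linarith [H.mul_lt_half]
    rcases le_max_iff.1 ih with h | h
    · refine le_trans ?_ (le_max_left _ _)
      nlinarith [H.mul_pos, sq_nonneg L]
    · refine le_trans ?_ (le_max_right _ _)
      rw [pow_succ (1 - e * L), mul_right_comm]
      linarith [mul_le_mul_of_nonneg_right h h1, sq_nonneg L]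

/-- Above the norm `1 / (1 - e) / (1 - e * L)` the map does not contract distances by more than a
constant factor. -/
theorem samMap_antilipschitz (H : NormalizedSpectrum l e L r)
    {u v : EuclideanSpace ℝ (Fin (n + 2))}
    (hu : 1 / (1 - e) / (1 - e * L) ≤ ‖u‖) (hv : 1 / (1 - e) / (1 - e * L) ≤ ‖v‖) :
    (e * L) ^ 3 * ‖u - v‖ ≤ ‖samMap l e u - samMap l e v‖ := by
  have h1 : 0 < 1 - e := by linarith [H.e_lt]
  have h2 : 0 < 1 - e * L := by linarith [H.mul_lt_half]
  have hL := H.pos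
  set θ := 1 / (1 - e) / (1 - e * L) with hθ
  have hθ0 : 0 < θ := by positivity
  have hθi : ∀ z : ℝ, z / θ = z * ((1 - e) * (1 - e * L)) := fun z => by
    rw [hθ]; field_simp
  have hin := inner_sub_sub_inv_norm_le hθ0 hu hv
  rw [hθi] at hin
  -- Division by `l i ^ 2` leaves the difference of the unit vectors minus a diagonal operator
  -- applied to `u - v`, with entries `(1 - e * l i) / l i ^ 2 ≥ 1 - e`. Since `1 / θ = (1 - e) * (1
  -- - e * L)` is smaller than `1 - e`, the operator wins: the inner product of `u - v` with `z` is
  -- at most `-(1 - e) * (e * L) * ‖u - v‖ ^ 2`.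
  set z : EuclideanSpace ℝ (Fin (n + 2)) :=
    WithLp.toLp 2 fun i => (samMap l e u - samMap l e v) i / l i ^ 2 with hz
  have hzn : ‖z‖ ≤ (1 / L ^ 2) * ‖samMap l e u - samMap l e v‖ := by
    refine norm_le_mul_of_forall_abs_le (by positivity) fun i => ?_
    have hli := H.coord_pos i
    rw [hz]
    simp only [abs_div]
    rw [abs_of_pos (pow_pos hli 2), div_eq_mul_one_div, mul_comm]
    refine mul_le_mul_of_nonneg_right ?_ (abs_nonneg _)
    exact one_div_le_one_div_of_le (by positivity) (pow_le_pow_left₀ hL.le (H.lower i) 2)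
  have hid : inner ℝ (u - v) (‖u‖⁻¹ • u - ‖v‖⁻¹ • v) - inner ℝ (u - v) z
      = ∑ i, (u i - v i) ^ 2 * ((1 - e * l i) / l i ^ 2) := by
    rw [inner_eq_sum_mul, inner_eq_sum_mul, ← Finset.sum_sub_distrib]
    refine Finset.sum_congr rfl fun i _ => ?_
    have hli := (H.coord_pos i).ne'
    have hun : ‖u‖ ≠ 0 := (hθ0.trans_le hu).ne'
    have hvn : ‖v‖ ≠ 0 := (hθ0.trans_le hv).ne'
    simp only [hz, PiLp.sub_apply, PiLp.smul_apply, smul_eq_mul, samMap_apply, growth]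
    field_simp
    ring
  have hlow : (1 - e) * ‖u - v‖ ^ 2 ≤ ∑ i, (u i - v i) ^ 2 * ((1 - e * l i) / l i ^ 2) := by
    rw [EuclideanSpace.real_norm_sq_eq, Finset.mul_sum]
    refine Finset.sum_le_sum fun i _ => ?_
    rw [mul_comm, PiLp.sub_apply]
    refine mul_le_mul_of_nonneg_left ?_ (sq_nonneg _)
    have hli := H.coord_pos i
    have hl1 := H.le_one i
    rw [le_div_iff₀ (by positivity)]
    have : l i ^ 2 ≤ 1 := by nlinarith
    nlinarith [H.e_pos]
  have hcs : -(‖u - v‖ * ‖z‖) ≤ inner ℝ (u - v) z := neg_le_of_abs_le (abs_real_inner_le_norm _ _)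
  have hmain : ((1 - e) * (e * L)) * ‖u - v‖ ^ 2 ≤ ‖u - v‖ * ‖z‖ := by nlinarith
  rcases eq_or_lt_of_le (norm_nonneg (u - v)) with h0 | hpos
  · rw [← h0]; simp
  have h5 : ((1 - e) * (e * L)) * ‖u - v‖ ≤ ‖z‖ := by
    refine le_of_mul_le_mul_left ?_ hpos
    linarith [hmain, show ‖u - v‖ * ((1 - e) * (e * L) * ‖u - v‖)
      = ((1 - e) * (e * L)) * ‖u - v‖ ^ 2 by ring]
  have h6 : L ^ 2 * ((1 - e) * (e * L)) * ‖u - v‖ ≤ ‖samMap l e u - samMap l e v‖ := by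
    have := mul_le_mul_of_nonneg_left (h5.trans hzn) (sq_nonneg L)
    rwa [← mul_assoc, ← mul_assoc (L ^ 2) (1 / L ^ 2), mul_one_div_cancel (pow_ne_zero 2 hL.ne'), one_mul] at this
  refine le_trans (mul_le_mul_of_nonneg_right ?_ (norm_nonneg _)) h6
  have h7 : (e * L) ^ 2 ≤ L ^ 2 * (1 - e) := by
    have : e ^ 2 ≤ 1 - e := by nlinarith [H.e_pos, H.e_lt]
    nlinarith [sq_nonneg L]
  calc (e * L) ^ 3 = (e * L) ^ 2 * (e * L) := by ring
    _ ≤ L ^ 2 * (1 - e) * (e * L) := mul_le_mul_of_nonneg_right h7 H.mul_pos.le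
    _ = _ := by ring

/-- Below the injectivity threshold the norm drops to where the leading factor is positive. -/
theorem norm_samMap_le_of_lt (H : NormalizedSpectrum l e L r)
    {u : EuclideanSpace ℝ (Fin (n + 2))} (hu : ‖u‖ < 1 / (1 - e) / (1 - e * L)) :
    ‖samMap l e u‖ ≤ max 1 (1 / (1 - e) - L ^ 2) := by
  refine (H.norm_samMap_le u).trans (max_le_max le_rfl ?_)
  have h2 : 0 < 1 - e * L := by linarith [H.mul_lt_half]
  rw [lt_div_iff₀ h2] at hu
  linarith

theorem lt_threshold_of_le_max (H : NormalizedSpectrum l e L r) {a : ℝ}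
    (ha : a ≤ max 1 (1 / (1 - e) - L ^ 2)) : a < 1 / (1 - e) / (1 - e * L) := by
  have h1 : 0 < 1 - e := by linarith [H.e_lt]
  have h2 : 0 < 1 - e * L := by linarith [H.mul_lt_half]
  have h3 : 1 < 1 / (1 - e) := by rw [lt_div_iff₀ h1]; linarith [H.e_pos]
  have h4 : 1 / (1 - e) < 1 / (1 - e) / (1 - e * L) := by
    rw [lt_div_iff₀ h2]
    nlinarith [H.mul_pos]
  refine ha.trans_lt (max_lt (h3.trans h4) ?_)
  nlinarith [pow_pos H.pos 2]

/-- Either `a ≤ 1`, where the factor is at least `e`, or `a` lies `L ^ 2` below the zero `1 / (1 -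
e)` of the factor. So no step after the crossing is dangerous. -/
theorem sq_le_growth_zero (H : NormalizedSpectrum l e L r) {a : ℝ} (ha0 : 0 < a)
    (ha : a ≤ max 1 (1 / (1 - e) - L ^ 2)) : (e * L) ^ 2 ≤ growth l e 0 a := by
  have h1 : 0 < 1 - e := by linarith [H.e_lt]
  rw [H.growth_zero]
  have hL := H.pos
  rcases le_max_iff.1 ha with h | h
  · have : 1 ≤ 1 / a := by rw [le_div_iff₀ ha0]; linarith
    nlinarith [H.mul_le, H.mul_pos, H.mul_lt_half]
  · have h3 : a * (1 - e) ≤ 1 - L ^ 2 * (1 - e) := by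
      have := mul_le_mul_of_nonneg_right h h1.le
      rwa [sub_mul, div_mul_cancel₀ _ h1.ne'] at this
    rw [le_sub_iff_add_le, le_div_iff₀ ha0]
    have h4 : (e * L) ^ 2 ≤ L ^ 2 / 4 := by nlinarith [H.two_mul_le, H.mul_pos]
    have ha2 : a ≤ 2 := by nlinarith [H.e_lt, sq_nonneg L, _root_.mul_pos (pow_pos hL 2) h1]
    nlinarith [H.e_lt, pow_pos hL 2, mul_nonneg (sub_nonneg.2 h4) ha0.le]

theorem sq_le_abs_growth_zero (H : NormalizedSpectrum l e L r) {a : ℝ}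
    (ha : 1 / (1 - e) / (1 - e * L) ≤ a) : (e * L) ^ 2 ≤ |growth l e 0 a| := by
  have h1 : 0 < 1 - e := by linarith [H.e_lt]
  have h2 : 0 < 1 - e * L := by linarith [H.mul_lt_half]
  have ha0 : 0 < a := lt_of_lt_of_le (by positivity) ha
  rw [H.growth_zero]
  refine le_trans ?_ (neg_le_abs _)
  have h3 : 1 / a ≤ (1 - e) * (1 - e * L) := by
    rw [div_div, div_le_iff₀ (by positivity)] at ha
    rw [div_le_iff₀ ha0]
    linarith
  nlinarith [H.mul_pos, H.mul_lt_half, H.e_lt]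

theorem div_le_abs_growth_zero (H : NormalizedSpectrum l e L r) {a τ : ℝ} (ha0 : 0 < a)
    (ha : a < 1 / (1 - e) / (1 - e * L)) (hτ : τ ≤ |a - 1 / (1 - e)|) :
    τ / 8 ≤ |growth l e 0 a| := by
  have h1 : 0 < 1 - e := by linarith [H.e_lt]
  have h2 : 0 < 1 - e * L := by linarith [H.mul_lt_half]
  have ha4 : a ≤ 4 := by
    rw [div_div, lt_div_iff₀ (by positivity)] at ha
    have : 1 / 2 * (1 / 2) ≤ (1 - e) * (1 - e * L) :=
      mul_le_mul (by linarith [H.e_lt]) (by linarith [H.mul_lt_half]) (by norm_num) h1.le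
    nlinarith
  rw [H.growth_zero]
  have e1 : 1 / a - (1 - e) = -((a - 1 / (1 - e)) * ((1 - e) / a)) := by
    field_simp; ring
  rw [e1, abs_neg, abs_mul, abs_of_pos (div_pos h1 ha0)]
  have h3 : 1 / 8 ≤ (1 - e) / a := by
    rw [le_div_iff₀ ha0]; linarith [H.e_lt]
  nlinarith [abs_nonneg (a - 1 / (1 - e))]

end NormalizedSpectrum

/-! ### Survival of the leading coordinate until entry into the unit ball. -/

namespace NormalizedSpectrum

variable {n : ℕ} {l : Fin (n + 2) → ℝ} {e L r : ℝ}

/-- Initial points whose orbit stays above the injectivity threshold before time `t` and has at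
time `t` a norm within `τ` of the zero of the leading growth factor. -/
def resonantSet (l : Fin (n + 2) → ℝ) (e L τ : ℝ) (t : ℕ) :
    Set (EuclideanSpace ℝ (Fin (n + 2))) :=
  {u | (∀ s < t, 1 / (1 - e) / (1 - e * L) ≤ ‖(samMap l e)^[s] u‖) ∧
    |‖(samMap l e)^[t] u‖ - 1 / (1 - e)| < τ}

/-- The threshold is crossed at most once, and only the crossing step can be resonant. That step
costs a factor `τ / 8`, any other step at most `(e * L) ^ 2`. -/
theorem le_abs_leading_coord (H : NormalizedSpectrum l e L r)
    {u : EuclideanSpace ℝ (Fin (n + 2))} (hu : u 0 ≠ 0) {τ : ℝ} (hτ0 : 0 < τ) (hτ1 : τ ≤ 1) {T : ℕ}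
    (hres : ∀ t < T, u ∉ resonantSet l e L τ t) :
    |u 0| * ((e * L) ^ 2) ^ T * (τ / 8) ≤ |(samMap l e)^[T] u 0| := by
  have hh : 0 < (e * L) ^ 2 := pow_pos H.mul_pos 2
  have hh1 : (e * L) ^ 2 ≤ 1 := by nlinarith [H.mul_pos, H.mul_lt_half]
  have habs : 0 < |u 0| := abs_pos.2 hu
  have key : ∀ t ≤ T,
      ((∀ s < t, 1 / (1 - e) / (1 - e * L) ≤ ‖(samMap l e)^[s] u‖) ∧
        |u 0| * ((e * L) ^ 2) ^ t ≤ |(samMap l e)^[t] u 0|) ∨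
      (‖(samMap l e)^[t] u‖ ≤ max 1 (1 / (1 - e) - L ^ 2) ∧
        |u 0| * ((e * L) ^ 2) ^ t * (τ / 8) ≤ |(samMap l e)^[t] u 0|) := by
    intro t
    induction t with
    | zero => intro _; left; simp
    | succ t ih =>
      intro htT
      have hstep : |(samMap l e)^[t + 1] u 0|
          = |(samMap l e)^[t] u 0| * |growth l e 0 ‖(samMap l e)^[t] u‖| := by
        rw [Function.iterate_succ_apply', samMap_apply, abs_mul]
      have hnorm : |(samMap l e)^[t] u 0| ≤ ‖(samMap l e)^[t] u‖ := abs_coord_le_norm _ _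
      have hpt : 0 < |u 0| * ((e * L) ^ 2) ^ t := by positivity
      rcases ih (by omega) with ⟨h1, h2⟩ | ⟨h1, h2⟩
      · by_cases hlt : ‖(samMap l e)^[t] u‖ < 1 / (1 - e) / (1 - e * L)
        · right
          refine ⟨?_, ?_⟩
          · rw [Function.iterate_succ_apply']
            exact H.norm_samMap_le_of_lt hlt
          · have hn : τ ≤ |‖(samMap l e)^[t] u‖ - 1 / (1 - e)| := by
              by_contra hc
              exact hres t (by omega) ⟨h1, not_le.1 hc⟩
            have hg := H.div_le_abs_growth_zero (hpt.trans_le (h2.trans hnorm)) hlt hn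
            rw [hstep]
            refine mul_le_mul (le_trans ?_ h2) hg (by positivity) (abs_nonneg _)
            -- The crossing step itself is paid for by `τ / 8`; the extra `(e * L) ^ 2` is given
            -- away to keep the exponent equal to the time.
            rw [pow_succ, ← mul_assoc]
            exact mul_le_of_le_one_right hpt.le hh1
        · left
          refine ⟨fun s hs => ?_, ?_⟩
          · rcases Nat.lt_succ_iff_lt_or_eq.1 hs with h | rfl
            · exact h1 s h
            · exact not_lt.1 hlt
          · rw [hstep, pow_succ, ← mul_assoc]
            exact mul_le_mul h2 (H.sq_le_abs_growth_zero (not_lt.1 hlt)) hh.le (abs_nonneg _)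
      · right
        have hpt' : 0 < |u 0| * ((e * L) ^ 2) ^ t * (τ / 8) := by positivity
        refine ⟨?_, ?_⟩
        · rw [Function.iterate_succ_apply']
          exact H.norm_samMap_le_of_lt (H.lt_threshold_of_le_max h1)
        · rw [hstep, pow_succ, ← mul_assoc, mul_right_comm]
          refine mul_le_mul h2 ?_ hh.le (abs_nonneg _)
          exact (H.sq_le_growth_zero (hpt'.trans_le (h2.trans hnorm)) h1).trans (le_abs_self _)
  rcases key T le_rfl with ⟨-, h2⟩ | ⟨-, h2⟩
  · refine le_trans ?_ h2
    exact mul_le_of_le_one_right (by positivity) (by linarith)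
  · exact h2

theorem iterate_antilipschitz (H : NormalizedSpectrum l e L r)
    {u v : EuclideanSpace ℝ (Fin (n + 2))} {t : ℕ}
    (hu : ∀ s < t, 1 / (1 - e) / (1 - e * L) ≤ ‖(samMap l e)^[s] u‖)
    (hv : ∀ s < t, 1 / (1 - e) / (1 - e * L) ≤ ‖(samMap l e)^[s] v‖) :
    ((e * L) ^ 3) ^ t * ‖u - v‖ ≤ ‖(samMap l e)^[t] u - (samMap l e)^[t] v‖ := by
  induction t with
  | zero => simp
  | succ t ih =>
    have h1 := ih (fun s hs => hu s (by omega)) fun s hs => hv s (by omega)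
    have h2 := H.samMap_antilipschitz (hu t (by omega)) (hv t (by omega))
    rw [Function.iterate_succ_apply', Function.iterate_succ_apply']
    refine le_trans ?_ h2
    rw [pow_succ, mul_comm (((e * L) ^ 3) ^ t), mul_assoc]
    exact mul_le_mul_of_nonneg_left h1 (pow_pos H.mul_pos 3).le

end NormalizedSpectrum

/-! ### Volumes of slabs, shells and preimages. -/

section Volume

/-- The inverse on the image is Lipschitz with constant `1 / c`, and `m`-dimensional Hausdorff
measure is a Haar measure, hence proportional to volume. This route asks for neither measurability
nor differentiability. -/
theorem volume_le_of_antilipschitzOn {m : ℕ} {s : Set (EuclideanSpace ℝ (Fin m))}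
    {f : EuclideanSpace ℝ (Fin m) → EuclideanSpace ℝ (Fin m)} {c : ℝ} (hc : 0 < c)
    (hf : ∀ x ∈ s, ∀ y ∈ s, c * ‖x - y‖ ≤ ‖f x - f y‖) :
    volume s ≤ ENNReal.ofReal (1 / c ^ m) * volume (f '' s) := by
  have hinj : Set.InjOn f s := fun x hx y hy hxy => by
    have := hf x hx y hy
    rw [hxy, sub_self, norm_zero] at this
    have h0 : ‖x - y‖ ≤ 0 := nonpos_of_mul_nonpos_right this hc
    exact sub_eq_zero.1 (norm_le_zero_iff.1 h0)
  obtain ⟨K, hK⟩ : ∃ K : NNReal, (K : ℝ) = 1 / c := ⟨⟨1 / c, by positivity⟩, rfl⟩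
  have hlip : LipschitzOnWith K (Function.invFunOn f s) (f '' s) := by
    refine LipschitzOnWith.of_dist_le_mul ?_
    rintro _ ⟨x, hx, rfl⟩ _ ⟨y, hy, rfl⟩
    rw [hinj.leftInvOn_invFunOn hx, hinj.leftInvOn_invFunOn hy, dist_eq_norm, dist_eq_norm, hK,
      one_div, ← div_eq_inv_mul, le_div_iff₀ hc, mul_comm]
    exact hf x hx y hy
  have himg : Function.invFunOn f s '' (f '' s) = s := by
    rw [Set.image_image]
    exact (Set.image_congr fun x hx => hinj.leftInvOn_invFunOn hx).trans (Set.image_id' s)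
  have hH := hlip.hausdorffMeasure_image_le (d := (m : ℝ)) (Nat.cast_nonneg m)
  rw [himg] at hH
  have hK' : (K : ENNReal) ^ (m : ℝ) = ENNReal.ofReal (1 / c ^ m) := by
    rw [ENNReal.rpow_natCast, ← ENNReal.ofReal_coe_nnreal, hK, ← ENNReal.ofReal_pow (by positivity),
      div_pow, one_pow]
  rw [hK'] at hH
  have hhaar : (Measure.hausdorffMeasure (m : ℝ) : Measure (EuclideanSpace ℝ (Fin m))).IsAddHaarMeasure := by
    have := isAddHaarMeasure_hausdorffMeasure (E := EuclideanSpace ℝ (Fin m))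
    simpa using this
  have hvol := Measure.isAddLeftInvariant_eq_smul
    (volume : Measure (EuclideanSpace ℝ (Fin m))) (Measure.hausdorffMeasure (m : ℝ))
  rw [hvol, Measure.smul_apply, Measure.smul_apply]
  simp only [ENNReal.smul_def, smul_eq_mul]
  rw [mul_left_comm]
  gcongr

theorem pow_sub_pow_le_mul {x y : ℝ} (hx : 0 ≤ x) (hxy : x ≤ y) (m : ℕ) :
    y ^ (m + 1) - x ^ (m + 1) ≤ (m + 1 : ℕ) * (y - x) * y ^ m := by
  induction m with
  | zero => simp
  | succ m ih =>
    have h1 : x ^ (m + 1) ≤ y ^ (m + 1) := pow_le_pow_left₀ hx hxy _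
    have h2 : y * (y ^ (m + 1) - x ^ (m + 1)) ≤ y * ((m + 1 : ℕ) * (y - x) * y ^ m) :=
      mul_le_mul_of_nonneg_left ih (hx.trans hxy)
    have h3 : (y - x) * x ^ (m + 1) ≤ (y - x) * y ^ (m + 1) :=
      mul_le_mul_of_nonneg_left h1 (by linarith)
    push_cast at h2 ⊢
    have e1 : y ^ (m + 1 + 1) - x ^ (m + 1 + 1)
        = y * (y ^ (m + 1) - x ^ (m + 1)) + (y - x) * x ^ (m + 1) := by ring
    have e2 : (m + 1 + 1 : ℝ) * (y - x) * y ^ (m + 1)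
        = y * ((m + 1 : ℝ) * (y - x) * y ^ m) + (y - x) * y ^ (m + 1) := by ring
    linarith

/-- The volume of a box with first half-side `σ` and the other half-sides `R`. -/
theorem volume_box_le {n : ℕ} {σ R : ℝ} (hσ : 0 ≤ σ) (hR : 0 ≤ R) :
    volume {w : EuclideanSpace ℝ (Fin (n + 2)) | |w 0| ≤ σ ∧ ∀ i, |w i| ≤ R} ≤
      ENNReal.ofReal (2 * σ * (2 * R) ^ (n + 1)) := by
  set b : Fin (n + 2) → ℝ := Fin.cons σ fun _ => R with hb
  have hsub : {w : EuclideanSpace ℝ (Fin (n + 2)) | |w 0| ≤ σ ∧ ∀ i, |w i| ≤ R} ⊆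
      (WithLp.ofLp : EuclideanSpace ℝ (Fin (n + 2)) → _) ⁻¹' Set.Icc (-b) b := by
    rintro w ⟨h0, h⟩
    have : ∀ i, |w i| ≤ b i := fun i => by
      refine Fin.cases ?_ (fun j => ?_) i
      · simpa [hb] using h0
      · simpa [hb] using h j.succ
    exact ⟨fun i => (abs_le.1 (this i)).1, fun i => (abs_le.1 (this i)).2⟩
  refine (measure_mono hsub).trans ?_
  rw [(PiLp.volume_preserving_ofLp (Fin (n + 2))).measure_preimage measurableSet_Icc.nullMeasurableSet,
    Real.volume_Icc_pi, Fin.prod_univ_succ, ENNReal.ofReal_mul (by positivity)]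
  simp only [hb, Pi.neg_apply, Fin.cons_zero, Fin.cons_succ, sub_neg_eq_add, Finset.prod_const,
    Finset.card_univ, Fintype.card_fin]
  rw [← ENNReal.ofReal_pow (by linarith), two_mul, two_mul]

theorem volume_closedBall_le {n : ℕ} {R : ℝ} (hR : 0 ≤ R) :
    volume {w : EuclideanSpace ℝ (Fin (n + 2)) | ‖w‖ ≤ R} ≤ ENNReal.ofReal ((2 * R) ^ (n + 2)) := by
  refine (measure_mono fun w (hw : ‖w‖ ≤ R) => ?_).trans
    ((volume_box_le (n := n) hR hR).trans_eq (by rw [pow_succ' (2 * R) (n + 1)]))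
  exact ⟨(abs_coord_le_norm w 0).trans hw, fun i => (abs_coord_le_norm w i).trans hw⟩

theorem volume_slab_le {n : ℕ} {σ R : ℝ} (hσ : 0 ≤ σ) (hR : 0 ≤ R) :
    volume {w : EuclideanSpace ℝ (Fin (n + 2)) | ‖w‖ ≤ R ∧ |w 0| ≤ σ} ≤
      ENNReal.ofReal (2 * σ * (2 * R) ^ (n + 1)) := by
  refine (measure_mono ?_).trans (volume_box_le hσ hR)
  rintro w ⟨h1, h2⟩
  exact ⟨h2, fun i => (abs_coord_le_norm w i).trans h1⟩

theorem volume_shell_le {n : ℕ} {θ τ : ℝ} (hτ0 : 0 < τ) (hτ1 : τ ≤ 1) (hθ1 : 1 ≤ θ)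
    (hθ2 : θ ≤ 2) :
    volume {w : EuclideanSpace ℝ (Fin (n + 2)) | |‖w‖ - θ| < τ} ≤
      ENNReal.ofReal (τ * ((n + 2 : ℕ) * 6 ^ (n + 2))) := by
  have hsub : {w : EuclideanSpace ℝ (Fin (n + 2)) | |‖w‖ - θ| < τ} ⊆
      Metric.ball 0 (θ + τ) \ Metric.closedBall 0 (θ - τ) := fun w hw => by
    rw [Set.mem_ofPred_eq, abs_lt] at hw
    simp only [Set.mem_sdiff, mem_ball_zero_iff, mem_closedBall_zero_iff, not_le]
    constructor <;> linarith
  refine (measure_mono hsub).trans ?_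
  rw [measure_sdiff (Metric.closedBall_subset_ball (by linarith))
    measurableSet_closedBall.nullMeasurableSet measure_closedBall_lt_top.ne,
    Measure.addHaar_ball _ _ (by linarith), Measure.addHaar_closedBall _ _ (by linarith),
    ← ENNReal.sub_mul fun _ _ => measure_ball_lt_top.ne,
    ← ENNReal.ofReal_sub _ (pow_nonneg (by linarith) _), finrank_euclideanSpace_fin]
  have hball : volume (Metric.ball (0 : EuclideanSpace ℝ (Fin (n + 2))) 1) ≤
      ENNReal.ofReal (2 ^ (n + 2)) := by
    refine (measure_mono fun w hw => ?_).trans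
      ((volume_closedBall_le (n := n) zero_le_one).trans_eq (by rw [mul_one]))
    exact (mem_ball_zero_iff.1 hw).le
  have hpow : (θ + τ) ^ (n + 2) - (θ - τ) ^ (n + 2) ≤ (n + 2 : ℕ) * (2 * τ) * 3 ^ (n + 1) := by
    refine (pow_sub_pow_le_mul (by linarith) (by linarith) (n + 1)).trans ?_
    rw [show θ + τ - (θ - τ) = 2 * τ by ring]
    refine mul_le_mul_of_nonneg_left (pow_le_pow_left₀ (by linarith) (by linarith) _) ?_
    positivity
  refine (mul_le_mul' (ENNReal.ofReal_le_ofReal hpow) hball).trans ?_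
  rw [← ENNReal.ofReal_mul (by positivity)]
  refine ENNReal.ofReal_le_ofReal ?_
  rw [show (6 : ℝ) ^ (n + 2) = 3 ^ (n + 2) * 2 ^ (n + 2) by rw [← mul_pow]; norm_num,
    pow_succ' (3 : ℝ) (n + 1)]
  have : 0 ≤ ((n + 2 : ℕ) : ℝ) * τ * 3 ^ (n + 1) * 2 ^ (n + 2) := by positivity
  nlinarith

end Volume

/-! ### The Lyapunov function, alignment with the leading axis, and convergence. -/

namespace NormalizedSpectrum

variable {n : ℕ} {l : Fin (n + 2) → ℝ} {e L r : ℝ}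

/-- The Lyapunov function `½ uᵀ C u - ‖u‖`, shifted to have minimum `0`. -/
noncomputable def excess (l : Fin (n + 2) → ℝ) (e : ℝ) (u : EuclideanSpace ℝ (Fin (n + 2))) : ℝ :=
  (∑ i, u i ^ 2 * ((2 - e * l i) / l i ^ 2)) / 2 - ‖u‖ + 1 / (2 - e) / 2

/-- Let `g = C u - u / ‖u‖` and `D = diag(l i ^ 2)`; the map is `u ↦ u - D g`. Cauchy-Schwarz
replaces `-‖samMap l e u‖` by the linearization of the concave part, and what remains is exact: `-gᵀ
D g + ½ gᵀ D C D g = -(e / 2) * ∑ l i ^ 3 * g i ^ 2`. -/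
theorem excess_samMap_le (H : NormalizedSpectrum l e L r)
    {u : EuclideanSpace ℝ (Fin (n + 2))} (hu : u ≠ 0) :
    excess l e (samMap l e u) ≤ excess l e u -
      e / 2 * ∑ i, l i ^ 3 * (u i ^ 2 * ((2 - e * l i) / l i ^ 2 - 1 / ‖u‖) ^ 2) := by
  have ha : 0 < ‖u‖ := norm_pos_iff.2 hu
  have hcs : (∑ i, samMap l e u i * u i) / ‖u‖ ≤ ‖samMap l e u‖ := by
    rw [div_le_iff₀ ha, ← inner_eq_sum_mul]
    exact real_inner_le_norm _ _
  have hn : (∑ i, u i ^ 2) / ‖u‖ = ‖u‖ := by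
    rw [← EuclideanSpace.real_norm_sq_eq, sq, mul_div_cancel_right₀ _ ha.ne']
  have hid : (∑ i, samMap l e u i ^ 2 * ((2 - e * l i) / l i ^ 2)) / 2
      - (∑ i, samMap l e u i * u i) / ‖u‖ =
      (∑ i, u i ^ 2 * ((2 - e * l i) / l i ^ 2)) / 2 - (∑ i, u i ^ 2) / ‖u‖ -
      e / 2 * ∑ i, l i ^ 3 * (u i ^ 2 * ((2 - e * l i) / l i ^ 2 - 1 / ‖u‖) ^ 2) := by
    rw [Finset.sum_div, Finset.sum_div, Finset.sum_div, Finset.sum_div, Finset.mul_sum,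
      ← Finset.sum_sub_distrib, ← Finset.sum_sub_distrib, ← Finset.sum_sub_distrib]
    refine Finset.sum_congr rfl fun i _ => ?_
    have hli := (H.coord_pos i).ne'
    have ha' := ha.ne'
    rw [samMap_apply, growth]
    generalize u.ofLp i = x
    generalize ‖u‖ = a at *
    field_simp
    ring
  unfold excess
  linarith

/-- Splits the excess into a radial part and a part that vanishes on the leading axis, both
nonnegative. -/
theorem excess_eq (H : NormalizedSpectrum l e L r) (u : EuclideanSpace ℝ (Fin (n + 2))) :
    excess l e u = (‖u‖ * (2 - e) - 1) ^ 2 / (2 - e) / 2 +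
      (∑ i, u i ^ 2 * ((2 - e * l i) / l i ^ 2 - (2 - e))) / 2 := by
  have h2 : 2 - e ≠ 0 := by linarith [H.e_lt]
  have hs : ∑ i, u i ^ 2 * ((2 - e * l i) / l i ^ 2 - (2 - e)) =
      ∑ i, u i ^ 2 * ((2 - e * l i) / l i ^ 2) - ‖u‖ ^ 2 * (2 - e) := by
    rw [EuclideanSpace.real_norm_sq_eq, Finset.sum_mul, ← Finset.sum_sub_distrib]
    exact Finset.sum_congr rfl fun i _ => by ring
  rw [hs, excess]
  generalize ∑ i, u i ^ 2 * ((2 - e * l i) / l i ^ 2) = S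
  field_simp
  ring

theorem curvature_sub_nonneg (H : NormalizedSpectrum l e L r) (i : Fin (n + 2)) :
    0 ≤ (2 - e * l i) / l i ^ 2 - (2 - e) := by
  have h := H.coord_pos i
  have h1 := H.le_one i
  have he := H.e_pos
  rw [sub_nonneg, le_div_iff₀ (by positivity)]
  have : l i ^ 2 ≤ 1 := by nlinarith
  nlinarith [H.e_lt]

theorem sq_div_four_le_excess (H : NormalizedSpectrum l e L r)
    (u : EuclideanSpace ℝ (Fin (n + 2))) : (‖u‖ * (2 - e) - 1) ^ 2 / 4 ≤ excess l e u := by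
  rw [H.excess_eq]
  have h1 : 0 ≤ ∑ i, u i ^ 2 * ((2 - e * l i) / l i ^ 2 - (2 - e)) :=
    Finset.sum_nonneg fun i _ => mul_nonneg (sq_nonneg _) (H.curvature_sub_nonneg i)
  have h2 : (‖u‖ * (2 - e) - 1) ^ 2 / 2 ≤ (‖u‖ * (2 - e) - 1) ^ 2 / (2 - e) :=
    div_le_div_of_nonneg_left (sq_nonneg _) (by linarith [H.e_lt]) (by linarith [H.e_pos])
  linarith

theorem excess_le (H : NormalizedSpectrum l e L r) {u : EuclideanSpace ℝ (Fin (n + 2))}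
    (hu : ‖u‖ ≤ 1) : excess l e u ≤ 2 / L ^ 2 := by
  have hL := H.pos
  have h1 : ∑ i, u i ^ 2 * ((2 - e * l i) / l i ^ 2) ≤ 2 / L ^ 2 := by
    calc _ ≤ ∑ i, u i ^ 2 * (2 / L ^ 2) := by
          refine Finset.sum_le_sum fun i _ => mul_le_mul_of_nonneg_left ?_ (sq_nonneg _)
          have := _root_.mul_pos H.e_pos (H.coord_pos i)
          exact div_le_div₀ (by norm_num) (by linarith) (by positivity)
            (pow_le_pow_left₀ hL.le (H.lower i) 2)
      _ = ‖u‖ ^ 2 * (2 / L ^ 2) := by rw [← Finset.sum_mul, EuclideanSpace.real_norm_sq_eq]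
      _ ≤ 1 * (2 / L ^ 2) := by
          refine mul_le_mul_of_nonneg_right ?_ (by positivity)
          nlinarith [norm_nonneg u]
      _ = _ := one_mul _
  have h2 : 1 / (2 - e) ≤ 1 := by
    rw [div_le_one₀ (by linarith [H.e_lt])]; linarith [H.e_lt]
  have h3 : 1 ≤ 1 / L ^ 2 := by
    rw [le_div_iff₀ (by positivity)]; nlinarith [H.L_le_one]
  have h4 : 2 / L ^ 2 = 2 * (1 / L ^ 2) := by ring
  unfold excess
  linarith [norm_nonneg u]

theorem excess_samMap_le_self (H : NormalizedSpectrum l e L r)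
    {u : EuclideanSpace ℝ (Fin (n + 2))} (hu : u ≠ 0) :
    excess l e (samMap l e u) ≤ excess l e u := by
  refine (H.excess_samMap_le hu).trans (sub_le_self _ ?_)
  refine mul_nonneg (by linarith [H.e_pos]) (Finset.sum_nonneg fun i _ => ?_)
  have := H.coord_pos i
  positivity

/-- When the norm exceeds that of the limit cycle, the excess decreases by a relative amount that is
proportional to the overshoot. -/
theorem excess_samMap_le_mul (H : NormalizedSpectrum l e L r)
    {u : EuclideanSpace ℝ (Fin (n + 2))} (hu1 : ‖u‖ ≤ 1) (hs : 0 ≤ ‖u‖ * (2 - e) - 1) :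
    excess l e (samMap l e u) ≤
      excess l e u * (1 - e * L * L ^ 2 * (‖u‖ * (2 - e) - 1)) := by
  have hu : u ≠ 0 := by
    rintro rfl
    simp at hs
    linarith
  have ha : 0 < ‖u‖ := norm_pos_iff.2 hu
  have hL := H.pos
  have he := H.e_pos
  set s := ‖u‖ * (2 - e) - 1 with hs_def
  set Γ := ∑ i, u i ^ 2 * ((2 - e * l i) / l i ^ 2 - (2 - e)) with hΓ
  have hΓ0 : 0 ≤ Γ :=
    Finset.sum_nonneg fun i _ => mul_nonneg (sq_nonneg _) (H.curvature_sub_nonneg i)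
  have hs1 : s ≤ 1 := by nlinarith
  set q := (2 - e) - 1 / ‖u‖ with hq
  have hqs : q = s / ‖u‖ := by rw [hq, hs_def]; field_simp
  have hqs' : s ≤ q := by
    rw [hqs, le_div_iff₀ ha]; nlinarith
  -- Each squared bracket is `(γ + q) ^ 2` with curvature gap `γ ≥ 0`. Dropping `γ ^ 2` leaves `q ^
  -- 2 + 2 * q * γ`, where `‖u‖ ^ 2 * q ^ 2 = s ^ 2` and `q ≥ s`.
  have h1 : L ^ 3 * (s ^ 2 + 2 * s * Γ) ≤
      ∑ i, l i ^ 3 * (u i ^ 2 * ((2 - e * l i) / l i ^ 2 - 1 / ‖u‖) ^ 2) := by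
    have e1 : s ^ 2 + 2 * q * Γ =
        ∑ i, u i ^ 2 * (q ^ 2 + 2 * q * ((2 - e * l i) / l i ^ 2 - (2 - e))) := by
      have : s ^ 2 = (∑ i, u i ^ 2) * q ^ 2 := by
        rw [← EuclideanSpace.real_norm_sq_eq, hqs]; field_simp
      rw [this, hΓ, Finset.sum_mul, Finset.mul_sum, ← Finset.sum_add_distrib]
      exact Finset.sum_congr rfl fun i _ => by ring
    calc L ^ 3 * (s ^ 2 + 2 * s * Γ) ≤ L ^ 3 * (s ^ 2 + 2 * q * Γ) := by gcongr
      _ = ∑ i, L ^ 3 * (u i ^ 2 * (q ^ 2 + 2 * q * ((2 - e * l i) / l i ^ 2 - (2 - e)))) := by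
          rw [e1, Finset.mul_sum]
      _ ≤ _ := by
          refine Finset.sum_le_sum fun i _ => ?_
          have hp := H.curvature_sub_nonneg i
          have hq0 : 0 ≤ q := hs.trans hqs'
          refine mul_le_mul (pow_le_pow_left₀ hL.le (H.lower i) 3) ?_ (by positivity)
            (pow_pos (H.coord_pos i) 3).le
          refine mul_le_mul_of_nonneg_left ?_ (sq_nonneg _)
          have e2 : (2 - e * l i) / l i ^ 2 - 1 / ‖u‖ =
            ((2 - e * l i) / l i ^ 2 - (2 - e)) + q := by rw [hq]; ring
          rw [e2]
          nlinarith [sq_nonneg ((2 - e * l i) / l i ^ 2 - (2 - e))]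
  have h2 : excess l e u ≤ (s ^ 2 + Γ) / 2 := by
    rw [H.excess_eq, ← hs_def, ← hΓ]
    have : s ^ 2 / (2 - e) ≤ s ^ 2 := div_le_self (sq_nonneg _) (by linarith [H.e_lt])
    linarith
  have h3 := H.excess_samMap_le hu
  have h4 : e / 2 * (L ^ 3 * (s ^ 2 + 2 * s * Γ)) ≤
      e / 2 * ∑ i, l i ^ 3 * (u i ^ 2 * ((2 - e * l i) / l i ^ 2 - 1 / ‖u‖) ^ 2) :=
    mul_le_mul_of_nonneg_left h1 (by linarith)
  have h5 : e * L ^ 3 * s * excess l e u ≤ e * L ^ 3 * s * ((s ^ 2 + Γ) / 2) :=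
    mul_le_mul_of_nonneg_left h2 (by positivity)
  have h6 : s * (s ^ 2 + Γ) ≤ s ^ 2 + 2 * s * Γ := by nlinarith [mul_nonneg hs hΓ0, sq_nonneg s]
  have h7 : e * L ^ 3 * (s * (s ^ 2 + Γ)) ≤ e * L ^ 3 * (s ^ 2 + 2 * s * Γ) :=
    mul_le_mul_of_nonneg_left h6 (by positivity)
  nlinarith

theorem growth_zero_pos (H : NormalizedSpectrum l e L r) {a : ℝ} (ha0 : 0 < a) (ha : a ≤ 1) :
    0 < growth l e 0 a := by
  rw [H.growth_zero]
  have : 1 ≤ 1 / a := by rw [le_div_iff₀ ha0]; linarith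
  linarith [H.e_pos]

/-- A positive factor is handled by the spectral gap. A negative one has modulus at most `1 - e *
L`, while an overshoot of at most `e * L / 4` keeps the leading factor above `1 - e * L / 2`; then
`1 - e * L ≤ (1 - e * L / 2) ^ 2` and `r ≤ e * L / 2` conclude. -/
theorem abs_growth_le_mul (H : NormalizedSpectrum l e L r) {a : ℝ} (ha0 : 0 < a)
    (hs : a * (2 - e) - 1 ≤ e * L / 4) {i : Fin (n + 2)} (hi : i ≠ 0) :
    |growth l e i a| ≤ (1 - r) * growth l e 0 a := by
  have hr := H.rate_pos
  have hr' := H.rate_le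
  have hh := H.mul_pos
  have hh' := H.mul_lt_half
  have he := H.e_pos
  have hel : e * L ≤ e * l i := mul_le_mul_of_nonneg_left (H.lower i) he.le
  have hel' : e * l i ≤ e * 1 := mul_le_mul_of_nonneg_left (H.le_one i) he.le
  rw [H.growth_zero, abs_le', growth]
  constructor
  · have h1 : l i ^ 2 / a ≤ (1 - r) * (1 / a) := by
      rw [mul_one_div]
      exact div_le_div_of_nonneg_right (H.gap i hi) ha0.le
    nlinarith [H.e_lt]
  · have h1 : 0 ≤ l i ^ 2 / a := by positivity
    have h2 : (2 - e) * (1 - e * L / 4) ≤ 1 / a := by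
      rw [le_div_iff₀ ha0]
      have : (1 - e * L / 4) * (a * (2 - e)) ≤ (1 - e * L / 4) * (1 + e * L / 4) :=
        mul_le_mul_of_nonneg_left (by linarith) (by linarith)
      nlinarith
    have h3 : 1 - e * L / 2 ≤ 1 / a - (1 - e) := by nlinarith
    have h4 : (1 - e * L / 2) * (1 - e * L / 2) ≤ (1 - r) * (1 / a - (1 - e)) :=
      mul_le_mul (by linarith) h3 (by linarith) (by linarith)
    nlinarith

theorem abs_growth_le_one (H : NormalizedSpectrum l e L r) {a : ℝ} (ha0 : 0 < a)
    (hs : 0 ≤ a * (2 - e) - 1) (i : Fin (n + 2)) : |growth l e i a| ≤ 1 := by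
  have he := H.e_pos
  have hli := H.coord_pos i
  have hl1 := H.le_one i
  have hel : 0 < e * l i := _root_.mul_pos he hli
  have hel' : e * l i ≤ e * 1 := mul_le_mul_of_nonneg_left hl1 he.le
  rw [abs_le', growth]
  constructor
  · have h1 : l i ^ 2 / a ≤ 2 - e := by
      rw [div_le_iff₀ ha0]
      nlinarith
    linarith
  · have h1 : 0 ≤ l i ^ 2 / a := by positivity
    linarith

/-- In terms of the overshoot `s` the leading factor is `(1 - (1 - e) * s) / (1 + s)`. The numerator
is the chord of the convex function `s ↦ e ^ s` on `[0, 1]`, which is where `log (1 / e)` comes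
from; at norm `1` the factor is only `e`. -/
theorem exp_le_growth_zero (H : NormalizedSpectrum l e L r) {a : ℝ} (ha0 : 0 < a) (ha : a ≤ 1)
    (hs : 0 ≤ a * (2 - e) - 1) :
    Real.exp (-((1 + Real.log (1 / e)) * (a * (2 - e) - 1))) ≤ growth l e 0 a := by
  have he := H.e_pos
  set s := a * (2 - e) - 1 with hs_def
  have hs1 : s ≤ 1 := by nlinarith [H.e_lt]
  have h1 : e ^ s ≤ 1 - (1 - e) * s := by
    have := rpow_one_add_le_one_add_mul_self (s := e - 1) (p := s) (by linarith) hs hs1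
    rw [add_sub_cancel] at this
    linarith
  have h2 : Real.exp (-s) ≤ 1 / (1 + s) := by
    rw [Real.exp_neg, one_div]
    exact inv_anti₀ (by linarith) (by linarith [Real.add_one_le_exp s])
  have h3 : Real.exp (-((1 + Real.log (1 / e)) * s)) = Real.exp (-s) * e ^ s := by
    rw [Real.rpow_def_of_pos he, ← Real.exp_add, one_div, Real.log_inv]
    congr 1
    ring
  have h4 : growth l e 0 a = 1 / (1 + s) * (1 - (1 - e) * s) := by
    have : 1 + s = a * (2 - e) := by rw [hs_def]; ring
    have h2e : 2 - e ≠ 0 := by linarith [H.e_lt]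
    rw [H.growth_zero, this, hs_def]
    field_simp
    ring
  rw [h3, h4]
  exact mul_le_mul h2 h1 (Real.rpow_nonneg he.le _) (by positivity)

/-- Excess truncated below at the level where overshoots stop being harmful. -/
noncomputable def truncExcess (l : Fin (n + 2) → ℝ) (e L : ℝ)
    (u : EuclideanSpace ℝ (Fin (n + 2))) : ℝ :=
  max (excess l e u) ((e * L) ^ 2 / 128)

theorem truncExcess_pos (H : NormalizedSpectrum l e L r) (u : EuclideanSpace ℝ (Fin (n + 2))) :
    0 < truncExcess l e L u :=
  lt_max_of_lt_right (by have := H.mul_pos; positivity)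

/-- Amortized contraction. A large overshoot `s` may enlarge the ratio by `exp ((1 + log (1 / e)) *
s)`, but it lowers the logarithm of the truncated excess by at least `e * L * L ^ 2 * s`, and the
prefactor converts this into credit. The `3` covers the `1` and also `r ≤ e * L / 2 ≤ 2 * s`. -/
theorem abs_growth_le_exp_mul (H : NormalizedSpectrum l e L r)
    {u : EuclideanSpace ℝ (Fin (n + 2))} (hu : u ≠ 0) (hu1 : ‖u‖ ≤ 1)
    {i : Fin (n + 2)} (hi : i ≠ 0) :
    |growth l e i ‖u‖| ≤ growth l e 0 ‖u‖ *
      Real.exp ((3 + Real.log (1 / (e * L))) / (e * L * L ^ 2) *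
        (Real.log (truncExcess l e L u) - Real.log (truncExcess l e L (samMap l e u))) - r) := by
  have ha0 : 0 < ‖u‖ := norm_pos_iff.2 hu
  have hh := H.mul_pos
  have hL := H.pos
  have hM := H.truncExcess_pos u
  have hM' := H.truncExcess_pos (samMap l e u)
  have hlog : 0 ≤ Real.log (1 / (e * L)) := Real.log_nonneg (by
    rw [le_div_iff₀ hh]; linarith [H.mul_lt_half])
  have hg := H.growth_zero_pos ha0 hu1
  rcases le_or_gt (‖u‖ * (2 - e) - 1) (e * L / 4) with hs | hs
  · refine (H.abs_growth_le_mul ha0 hs hi).trans ?_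
    rw [mul_comm]
    refine mul_le_mul_of_nonneg_left ?_ hg.le
    have h1 : truncExcess l e L (samMap l e u) ≤ truncExcess l e L u :=
      max_le_max (H.excess_samMap_le_self hu) le_rfl
    have h2 := Real.log_le_log hM' h1
    have h3 : 0 ≤ (3 + Real.log (1 / (e * L))) / (e * L * L ^ 2) *
        (Real.log (truncExcess l e L u) - Real.log (truncExcess l e L (samMap l e u))) :=
      mul_nonneg (by positivity) (by linarith)
    refine le_trans ?_ (Real.exp_le_exp.2 (sub_le_sub_right h3 r))
    have := Real.add_one_le_exp (0 - r)
    linarith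
  · set s := ‖u‖ * (2 - e) - 1 with hs_def
    have hs0 : 0 ≤ s := by linarith
    have hs1 : s ≤ 1 := by nlinarith [H.e_lt, H.e_pos]
    refine (H.abs_growth_le_one ha0 hs0 i).trans ?_
    have hE := H.sq_div_four_le_excess u
    rw [← hs_def] at hE
    have hE' := H.excess_samMap_le_mul hu1 hs0
    rw [← hs_def] at hE'
    have hL2 : L ^ 2 ≤ 1 := by nlinarith [H.L_le_one]
    have hx0 : 0 ≤ e * L * L ^ 2 * s := by positivity
    have hx : e * L * L ^ 2 * s ≤ 1 / 2 := by
      calc e * L * L ^ 2 * s ≤ 1 / 2 * 1 * 1 := by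
            have := H.mul_lt_half
            gcongr
        _ = _ := by norm_num
    -- This is twice the truncation level, and the contraction factor is at least `1 / 2`, so
    -- truncation does not spoil the relative decrease.
    have hE0 : (e * L) ^ 2 / 64 ≤ excess l e u := by nlinarith
    have hMle : truncExcess l e L (samMap l e u) ≤
        truncExcess l e L u * (1 - e * L * L ^ 2 * s) := by
      have h1 : excess l e u * (1 - e * L * L ^ 2 * s) ≤
          truncExcess l e L u * (1 - e * L * L ^ 2 * s) :=
        mul_le_mul_of_nonneg_right (le_max_left _ _) (by linarith)
      refine max_le (hE'.trans h1) (le_trans ?_ h1)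
      nlinarith [sq_nonneg (e * L)]
    have hlogM : Real.log (truncExcess l e L (samMap l e u)) ≤
        Real.log (truncExcess l e L u) - e * L * L ^ 2 * s := by
      refine (Real.log_le_log hM' hMle).trans ?_
      rw [Real.log_mul hM.ne' (by linarith)]
      have := Real.log_le_sub_one_of_pos (show 0 < 1 - e * L * L ^ 2 * s by linarith)
      linarith
    have hβ : (3 + Real.log (1 / (e * L))) * s ≤
        (3 + Real.log (1 / (e * L))) / (e * L * L ^ 2) *
        (Real.log (truncExcess l e L u) - Real.log (truncExcess l e L (samMap l e u))) := by
      calc (3 + Real.log (1 / (e * L))) * s =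
          (3 + Real.log (1 / (e * L))) / (e * L * L ^ 2) * (e * L * L ^ 2 * s) := by
            rw [← mul_assoc, div_mul_cancel₀ _ (by positivity)]
        _ ≤ _ := mul_le_mul_of_nonneg_left (by linarith) (by positivity)
    have hle : Real.log (1 / e) ≤ Real.log (1 / (e * L)) :=
      Real.log_le_log (by have := H.e_pos; positivity)
        (one_div_le_one_div_of_le hh H.mul_le)
    have hexp : (1 + Real.log (1 / e)) * s ≤ (3 + Real.log (1 / (e * L))) / (e * L * L ^ 2) *
        (Real.log (truncExcess l e L u) - Real.log (truncExcess l e L (samMap l e u))) - r := by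
      nlinarith [H.rate_le, mul_le_mul_of_nonneg_right hle hs0]
    calc (1 : ℝ) = Real.exp (-((1 + Real.log (1 / e)) * s)) *
          Real.exp ((1 + Real.log (1 / e)) * s) := by rw [← Real.exp_add]; simp
      _ ≤ _ := mul_le_mul (H.exp_le_growth_zero ha0 hu1 hs0) (Real.exp_le_exp.2 hexp)
          (Real.exp_pos _).le hg.le

theorem iterate_leading_sign (H : NormalizedSpectrum l e L r)
    {u : EuclideanSpace ℝ (Fin (n + 2))} (hu0 : u 0 ≠ 0) (hu1 : ‖u‖ ≤ 1) (t : ℕ) :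
    0 < (samMap l e)^[t] u 0 * SignType.sign (u 0) ∧ ‖(samMap l e)^[t] u‖ ≤ 1 := by
  induction t with
  | zero =>
    refine ⟨?_, hu1⟩
    rw [Function.iterate_zero_apply, self_mul_sign]
    exact abs_pos.2 hu0
  | succ t ih =>
    rw [Function.iterate_succ_apply']
    refine ⟨?_, H.norm_samMap_le_one ih.2⟩
    have hne : (samMap l e)^[t] u ≠ 0 := fun h => by
      have := ih.1
      rw [h] at this
      simp at this
    have := H.growth_zero_pos (norm_pos_iff.2 hne) ih.2
    rw [samMap_apply, mul_right_comm]
    exact _root_.mul_pos ih.1 this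

theorem iterate_leading_ne_zero (H : NormalizedSpectrum l e L r)
    {u : EuclideanSpace ℝ (Fin (n + 2))} (hu0 : u 0 ≠ 0) (hu1 : ‖u‖ ≤ 1) (t : ℕ) :
    (samMap l e)^[t] u 0 ≠ 0 := fun h => by
  have := (H.iterate_leading_sign hu0 hu1 t).1
  rw [h, zero_mul] at this
  exact this.false

theorem iterate_ne_zero (H : NormalizedSpectrum l e L r)
    {u : EuclideanSpace ℝ (Fin (n + 2))} (hu0 : u 0 ≠ 0) (hu1 : ‖u‖ ≤ 1) (t : ℕ) :
    (samMap l e)^[t] u ≠ 0 := fun h => by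
  apply H.iterate_leading_ne_zero hu0 hu1 t
  rw [h]; rfl

theorem abs_iterate_le_exp_mul (H : NormalizedSpectrum l e L r)
    {u : EuclideanSpace ℝ (Fin (n + 2))} (hu0 : u 0 ≠ 0) (hu1 : ‖u‖ ≤ 1)
    {i : Fin (n + 2)} (hi : i ≠ 0) (t : ℕ) :
    |(samMap l e)^[t] u i| * |u 0| ≤ |(samMap l e)^[t] u 0| * |u i| *
      Real.exp ((3 + Real.log (1 / (e * L))) / (e * L * L ^ 2) *
        (Real.log (truncExcess l e L u) - Real.log (truncExcess l e L ((samMap l e)^[t] u)))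
          - r * t) := by
  induction t with
  | zero => simp [mul_comm]
  | succ t ih =>
    have hne := H.iterate_ne_zero hu0 hu1 t
    have hn1 := (H.iterate_leading_sign hu0 hu1 t).2
    have hstep := H.abs_growth_le_exp_mul hne hn1 hi
    have hg := H.growth_zero_pos (norm_pos_iff.2 hne) hn1
    rw [Function.iterate_succ_apply', samMap_apply, samMap_apply, abs_mul, abs_mul, abs_of_pos hg]
    set v := (samMap l e)^[t] u with hv
    calc |v i| * |growth l e i ‖v‖| * |u 0| = (|v i| * |u 0|) * |growth l e i ‖v‖| := by ring
      _ ≤ _ := mul_le_mul ih hstep (abs_nonneg _) (by positivity)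
      _ = _ := by
        rw [show ∀ a b c d f : ℝ, a * b * c * (d * f) = a * d * b * (c * f) by intros; ring,
          ← Real.exp_add]
        congr 2
        push_cast
        ring

theorem abs_iterate_le (H : NormalizedSpectrum l e L r)
    {u : EuclideanSpace ℝ (Fin (n + 2))} (hu0 : u 0 ≠ 0) (hu1 : ‖u‖ ≤ 1)
    {i : Fin (n + 2)} (hi : i ≠ 0) (t : ℕ) :
    |(samMap l e)^[t] u i| ≤ |(samMap l e)^[t] u 0| *
      (Real.exp ((3 + Real.log (1 / (e * L))) / (e * L * L ^ 2) * Real.log (64 / (e * L) ^ 4)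
          - r * t) / |u 0|) := by
  have hh := H.mul_pos
  have hL := H.pos
  have hlog : 0 ≤ Real.log (1 / (e * L)) := Real.log_nonneg (by
    rw [le_div_iff₀ hh]; linarith [H.mul_lt_half])
  have h := H.abs_iterate_le_exp_mul hu0 hu1 hi t
  set v := (samMap l e)^[t] u
  rw [← mul_div_assoc, le_div_iff₀ (abs_pos.2 hu0)]
  refine h.trans ?_
  have hui : |u i| ≤ 1 := (abs_coord_le_norm u i).trans hu1
  have hL1 := H.L_le_one
  have h1 : truncExcess l e L u ≤ 2 / L ^ 2 := by
    refine max_le (H.excess_le hu1) ?_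
    rw [div_le_div_iff₀ (by norm_num) (by positivity)]
    have : (e * L) ^ 2 * L ^ 2 ≤ 1 * 1 := by
      have := H.mul_lt_half
      gcongr <;> nlinarith
    linarith
  have h2 : (e * L) ^ 2 / 128 ≤ truncExcess l e L v := le_max_right _ _
  -- The quotient is at most `256 / ((e * L) ^ 2 * L ^ 2)`, and `2 * (e * L) ≤ L`.
  have h3 : Real.log (truncExcess l e L u) - Real.log (truncExcess l e L v) ≤
      Real.log (64 / (e * L) ^ 4) := by
    rw [← Real.log_div (H.truncExcess_pos u).ne' (H.truncExcess_pos v).ne']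
    refine Real.log_le_log (div_pos (H.truncExcess_pos u) (H.truncExcess_pos v)) ?_
    refine (div_le_div₀ (by positivity) h1 (by positivity) h2).trans ?_
    rw [div_div, div_le_div_iff₀ (by positivity) (by positivity)]
    have h4 : (2 * (e * L)) ^ 2 ≤ L ^ 2 := pow_le_pow_left₀ (by positivity) H.two_mul_le 2
    nlinarith [mul_le_mul_of_nonneg_right h4 (sq_nonneg (e * L))]
  have h4 : |v 0| * |u i| ≤ |v 0| := mul_le_of_le_one_right (abs_nonneg _) hui
  refine mul_le_mul h4 (Real.exp_le_exp.2 ?_) (Real.exp_pos _).le (abs_nonneg _)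
  refine sub_le_sub_right (mul_le_mul_of_nonneg_left h3 (by positivity)) _

/-- In modulus the leading coordinate `y` becomes `y / ‖u‖ - (1 - e) * y`. On the axis this is `1 -
(1 - e) * y`, a contraction about `1 / (2 - e)`. The defect `1 - y / ‖u‖` is at most `1 - (y / ‖u‖)
^ 2`, the off-axis share of the squared norm. -/
theorem leading_error_step (H : NormalizedSpectrum l e L r)
    {u : EuclideanSpace ℝ (Fin (n + 2))} (hu0 : u 0 ≠ 0) (hu1 : ‖u‖ ≤ 1) {χ : ℝ}
    (hχ : ∀ i, i ≠ 0 → |u i| ≤ |u 0| * χ) :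
    |(|samMap l e u 0| - 1 / (2 - e))| ≤
      (1 - e) * |(|u 0| - 1 / (2 - e))| + (n + 2 : ℕ) * χ ^ 2 := by
  have hne : u ≠ 0 := fun h => hu0 (by rw [h]; rfl)
  have ha := norm_pos_iff.2 hne
  have hx := abs_pos.2 hu0
  have hxa := abs_coord_le_norm u 0
  have hg := H.growth_zero_pos ha hu1
  have h2e : 2 - e ≠ 0 := by linarith [H.e_lt]
  have e1 : |samMap l e u 0| - 1 / (2 - e) =
      -((1 - e) * (|u 0| - 1 / (2 - e))) - (1 - |u 0| / ‖u‖) := by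
    rw [samMap_apply, abs_mul, abs_of_pos hg, H.growth_zero]
    field_simp
    ring
  have hq1 : |u 0| / ‖u‖ ≤ 1 := div_le_one_of_le₀ hxa ha.le
  have hsum : ‖u‖ ^ 2 - |u 0| ^ 2 ≤ (n + 2 : ℕ) * (‖u‖ ^ 2 * χ ^ 2) := by
    rw [EuclideanSpace.real_norm_sq_eq, Fin.sum_univ_succ, sq_abs, add_sub_cancel_left,
      ← Fin.sum_univ_succ (fun i => u i ^ 2), ← EuclideanSpace.real_norm_sq_eq]
    calc ∑ i : Fin (n + 1), u i.succ ^ 2 ≤ ∑ _i : Fin (n + 1), ‖u‖ ^ 2 * χ ^ 2 := by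
          refine Finset.sum_le_sum fun i _ => ?_
          have h1 := hχ i.succ (Fin.succ_ne_zero i)
          rw [← sq_abs, ← mul_pow]
          refine pow_le_pow_left₀ (abs_nonneg _) (h1.trans ?_) 2
          have hχ0 : 0 ≤ χ := by
            have := (abs_nonneg _).trans h1
            exact nonneg_of_mul_nonneg_right this hx
          exact mul_le_mul_of_nonneg_right hxa hχ0
      _ = (n + 1 : ℕ) * (‖u‖ ^ 2 * χ ^ 2) := by simp
      _ ≤ _ := by
          refine mul_le_mul_of_nonneg_right ?_ (by positivity)
          exact_mod_cast Nat.le_succ _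
  have hq2 : 1 - |u 0| / ‖u‖ ≤ (n + 2 : ℕ) * χ ^ 2 := by
    have h1 : 1 - |u 0| / ‖u‖ ≤ 1 - (|u 0| / ‖u‖) ^ 2 := by
      have : 0 ≤ |u 0| / ‖u‖ := by positivity
      nlinarith
    have h2 : 1 - (|u 0| / ‖u‖) ^ 2 = (‖u‖ ^ 2 - |u 0| ^ 2) / ‖u‖ ^ 2 := by
      field_simp
    refine h1.trans ?_
    rw [h2, div_le_iff₀ (by positivity)]
    linarith
  rw [e1]
  refine (abs_sub _ _).trans (add_le_add ?_ ?_)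
  · rw [abs_neg, abs_mul, abs_of_pos (by linarith [H.e_lt])]
  · rwa [abs_of_nonneg (by linarith)]

/-- Convergence to the fixed point, once the off-axis part stays small. -/
theorem leading_error_le (H : NormalizedSpectrum l e L r)
    {u : EuclideanSpace ℝ (Fin (n + 2))} (hu0 : u 0 ≠ 0) (hu1 : ‖u‖ ≤ 1) {χ : ℝ}
    (hχ : ∀ t i, i ≠ 0 → |(samMap l e)^[t] u i| ≤ |(samMap l e)^[t] u 0| * χ) (t : ℕ) :
    |(|(samMap l e)^[t] u 0| - 1 / (2 - e))| ≤ (1 - e) ^ t + (n + 2 : ℕ) * χ ^ 2 / e := by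
  have he := H.e_pos
  induction t with
  | zero =>
    have h1 := (abs_coord_le_norm u 0).trans hu1
    have h2 : 0 < 1 / (2 - e) := one_div_pos.2 (by linarith [H.e_lt])
    have h3 : 1 / (2 - e) ≤ 1 := by
      rw [div_le_one₀ (by linarith [H.e_lt])]; linarith [H.e_lt]
    have h4 : 0 ≤ (n + 2 : ℕ) * χ ^ 2 / e := by positivity
    rw [pow_zero, Function.iterate_zero_apply]
    have : |(|u 0| - 1 / (2 - e))| ≤ 1 := by
      rw [abs_le]; constructor <;> linarith [abs_nonneg (u 0)]
    linarith
  | succ t ih =>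
    have h := H.leading_error_step (H.iterate_leading_ne_zero hu0 hu1 t)
      (H.iterate_leading_sign hu0 hu1 t).2 (hχ t)
    rw [Function.iterate_succ_apply']
    refine h.trans ?_
    have h1 := mul_le_mul_of_nonneg_left ih (show 0 ≤ 1 - e by linarith [H.e_lt])
    have h2 : (n + 2 : ℕ) * χ ^ 2 / e = (1 - e) * ((n + 2 : ℕ) * χ ^ 2 / e) + (n + 2 : ℕ) * χ ^ 2 := by
      field_simp
      ring
    rw [h2, pow_succ' (1 - e)]
    linarith

theorem norm_iterate_sub_le (H : NormalizedSpectrum l e L r)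
    {u : EuclideanSpace ℝ (Fin (n + 2))} (hu0 : u 0 ≠ 0) (hu1 : ‖u‖ ≤ 1) {χ : ℝ}
    (hχ : ∀ t i, i ≠ 0 → |(samMap l e)^[t] u i| ≤ |(samMap l e)^[t] u 0| * χ) (t : ℕ) :
    ‖(samMap l e)^[t] u - ((SignType.sign (u 0) : ℝ) * (1 / (2 - e))) •
        EuclideanSpace.single (0 : Fin (n + 2)) (1 : ℝ)‖ ≤
      (1 - e) ^ t + (n + 2 : ℕ) * χ ^ 2 / e + (n + 2 : ℕ) * χ := by
  have hpos := (H.iterate_leading_sign hu0 hu1 t).1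
  have hn1 := (H.iterate_leading_sign hu0 hu1 t).2
  have herr := H.leading_error_le hu0 hu1 hχ t
  have hχt := hχ t
  set v := (samMap l e)^[t] u
  have hv0 : 0 < |v 0| := abs_pos.2 (H.iterate_leading_ne_zero hu0 hu1 t)
  have hχ0 : 0 ≤ χ := by
    have := (abs_nonneg _).trans (hχt 1 (by simp))
    exact nonneg_of_mul_nonneg_right this hv0
  set σ : ℝ := (SignType.sign (u 0) : ℝ) with hσ
  have hσσ : σ * σ = 1 ∧ |σ| = 1 := by
    rcases lt_or_gt_of_ne hu0 with h | h
    · rw [hσ, sign_neg h]; simp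
    · rw [hσ, sign_pos h]; simp
  have hv0' : v 0 = σ * |v 0| := by
    have h1 : |v 0| = v 0 * σ := by
      rw [← abs_of_pos hpos, abs_mul, hσσ.2, mul_one]
    rw [h1, mul_comm, mul_assoc, hσσ.1, mul_one]
  set z := v - (σ * (1 / (2 - e))) • EuclideanSpace.single (0 : Fin (n + 2)) (1 : ℝ) with hz
  have hz0 : |z 0| = |(|v 0| - 1 / (2 - e))| := by
    have : z 0 = σ * (|v 0| - 1 / (2 - e)) := by
      simp only [hz, PiLp.sub_apply, PiLp.smul_apply, smul_eq_mul, PiLp.single_apply,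
        if_true, mul_one]
      rw [mul_sub, ← hv0']
    rw [this, abs_mul, hσσ.2, one_mul]
  have hzi : ∀ i : Fin (n + 1), |z i.succ| ≤ χ := fun i => by
    have : z i.succ = v i.succ := by
      simp [hz]
    rw [this]
    refine (hχt _ (Fin.succ_ne_zero i)).trans (mul_le_of_le_one_left hχ0 ?_)
    exact (abs_coord_le_norm v 0).trans hn1
  have hsum : ‖z‖ ≤ ∑ i, |z i| := by
    refine le_of_sq_le_sq ?_ (Finset.sum_nonneg fun i _ => abs_nonneg _)
    rw [EuclideanSpace.real_norm_sq_eq]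
    simp_rw [← sq_abs (z _)]
    exact Finset.sum_sq_le_sq_sum_of_nonneg fun i _ => abs_nonneg _
  refine hsum.trans ?_
  rw [Fin.sum_univ_succ, hz0]
  refine add_le_add herr ((Finset.sum_le_sum fun i _ => hzi i).trans ?_)
  rw [Finset.sum_const, Finset.card_univ, Fintype.card_fin, nsmul_eq_mul]
  refine mul_le_mul_of_nonneg_right ?_ hχ0
  exact_mod_cast Nat.le_succ _

end NormalizedSpectrum

/-! ### A uniform convergence time inside the unit ball. -/

namespace NormalizedSpectrum

variable {n : ℕ} {l : Fin (n + 2) → ℝ} {e L r : ℝ}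

/-- Uniform convergence time, once the norm is at most `1` and the leading coordinate is not
exponentially small. -/
theorem exists_sign_norm_iterate_sub_le (H : NormalizedSpectrum l e L r) {x : ℝ} (hx2 : 2 ≤ x)
    (hxh : Real.exp (-x) ≤ e * L) (hxn : ((n + 2 : ℕ) : ℝ) ≤ x)
    {u : EuclideanSpace ℝ (Fin (n + 2))} {T : ℝ} (hT : T ≤ 3 * x / (e * L)) (hu1 : ‖u‖ ≤ 1)
    (hu0 : Real.exp (-(6 * x ^ 2 * T)) ≤ |u 0|) :
    ∃ σ : ℝ, (σ = 1 ∨ σ = -1) ∧ ∀ t : ℕ,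
      (21 * x ^ 2 / (e * L * L ^ 2) + 18 * x ^ 3 / (e * L) + 5 * x) / r + 1 +
        (4 * x / (e * L) + 1) ≤ t →
      ‖(samMap l e)^[t] u - (σ * (1 / (2 - e))) •
        EuclideanSpace.single (0 : Fin (n + 2)) (1 : ℝ)‖ ≤ Real.exp (-(3 * x)) := by
  have hh := H.mul_pos
  have hL := H.pos
  have hr := H.rate_pos
  have hne : u 0 ≠ 0 := abs_pos.1 ((Real.exp_pos _).trans_le hu0)
  -- The three terms pay for the amortization constant, for `log (1 / |u 0|)`, and for a final ratio
  -- `exp (-5x)`. A factor `n + 2 ≤ exp x` then leaves three errors of size `exp (-4x)`, whose sum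
  -- is at most `exp (-3x)`.
  set B := (21 * x ^ 2 / (e * L * L ^ 2) + 18 * x ^ 3 / (e * L) + 5 * x) / r with hB
  have hB0 : 0 ≤ B := by positivity
  set T₂ := ⌈B⌉₊ with hT₂
  set v := (samMap l e)^[T₂] u with hv
  have hv0 : v 0 ≠ 0 := H.iterate_leading_ne_zero hne hu1 T₂
  have hv1 : ‖v‖ ≤ 1 := (H.iterate_leading_sign hne hu1 T₂).2
  have hlog : Real.log (1 / (e * L)) ≤ x := by
    rw [one_div, Real.log_inv]
    have := (Real.le_log_iff_exp_le hh).2 hxh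
    linarith
  have hlog0 : 0 ≤ Real.log (1 / (e * L)) := Real.log_nonneg (by
    rw [le_div_iff₀ hh]; linarith [H.mul_lt_half])
  have hlog64 : Real.log (64 / (e * L) ^ 4) ≤ 7 * x := by
    rw [show 64 / (e * L) ^ 4 = 2 ^ 6 * (1 / (e * L)) ^ 4 by field_simp; norm_num,
      Real.log_mul (by norm_num) (by positivity), Real.log_pow, Real.log_pow]
    have := Real.log_two_lt_d9
    push_cast
    linarith
  have hexp : (3 + Real.log (1 / (e * L))) / (e * L * L ^ 2) * Real.log (64 / (e * L) ^ 4) ≤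
      21 * x ^ 2 / (e * L * L ^ 2) := by
    rw [div_mul_eq_mul_div]
    refine div_le_div_of_nonneg_right ?_ (by positivity)
    calc (3 + Real.log (1 / (e * L))) * Real.log (64 / (e * L) ^ 4)
        ≤ (3 * x) * (7 * x) := mul_le_mul (by linarith) hlog64
          (Real.log_nonneg (by
            rw [le_div_iff₀ (by positivity)]
            have : (e * L) ^ 4 ≤ 1 := pow_le_one₀ hh.le (by linarith [H.mul_lt_half])
            linarith)) (by linarith)
      _ = 21 * x ^ 2 := by ring
  have hKT : 6 * x ^ 2 * T ≤ 18 * x ^ 3 / (e * L) := by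
    calc 6 * x ^ 2 * T ≤ 6 * x ^ 2 * (3 * x / (e * L)) :=
          mul_le_mul_of_nonneg_left hT (by positivity)
      _ = _ := by ring
  have hχ : ∀ t i, i ≠ 0 → |(samMap l e)^[t] v i| ≤
      |(samMap l e)^[t] v 0| * Real.exp (-(5 * x)) := by
    intro t i hi
    have h := H.abs_iterate_le hne hu1 hi (t + T₂)
    rw [Function.iterate_add_apply, ← hv] at h
    refine h.trans (mul_le_mul_of_nonneg_left ?_ (abs_nonneg _))
    rw [div_le_iff₀ (abs_pos.2 hne)]
    refine le_trans ?_ (mul_le_mul_of_nonneg_left hu0 (Real.exp_pos _).le)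
    rw [← Real.exp_add]
    refine Real.exp_le_exp.2 ?_
    have h1 : B ≤ T₂ := Nat.le_ceil _
    have h2 : r * B = 21 * x ^ 2 / (e * L * L ^ 2) + 18 * x ^ 3 / (e * L) + 5 * x := by
      rw [hB, mul_div_cancel₀ _ hr.ne']
    have h3 : r * B ≤ r * T₂ := mul_le_mul_of_nonneg_left h1 hr.le
    have h4 : 0 ≤ r * t := by positivity
    push_cast
    linarith
  refine ⟨(SignType.sign (v 0) : ℝ), ?_, fun t ht => ?_⟩
  · rcases lt_or_gt_of_ne hv0 with h | h
    · right; rw [sign_neg h]; simp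
    · left; rw [sign_pos h]; simp
  have hT₂' : (T₂ : ℝ) < B + 1 := Nat.ceil_lt_add_one hB0
  have hx0 : 0 ≤ 4 * x / (e * L) := by positivity
  have hle : T₂ ≤ t := by
    have : (T₂ : ℝ) ≤ t := by linarith
    exact_mod_cast this
  obtain ⟨k, rfl⟩ := Nat.exists_eq_add_of_le' hle
  have hk : 4 * x / (e * L) ≤ k := by
    push_cast at ht
    linarith
  have h := H.norm_iterate_sub_le hv0 hv1 hχ k
  rw [Function.iterate_add_apply, ← hv]
  refine h.trans ?_
  have he := H.e_pos
  have hxe : (n + 2 : ℕ) ≤ Real.exp x := hxn.trans (by linarith [Real.add_one_le_exp x])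
  have h1 : (1 - e) ^ k ≤ Real.exp (-(4 * x)) := by
    have h2 : (1 - e) ^ k ≤ Real.exp (-e) ^ k :=
      pow_le_pow_left₀ (by linarith [H.e_lt]) (by linarith [Real.add_one_le_exp (-e)]) k
    refine h2.trans ?_
    rw [← Real.exp_nat_mul]
    refine Real.exp_le_exp.2 ?_
    rw [div_le_iff₀ hh] at hk
    have : (k : ℝ) * (e * L) ≤ k * e := mul_le_mul_of_nonneg_left H.mul_le (Nat.cast_nonneg k)
    linarith
  have h2 : (n + 2 : ℕ) * Real.exp (-(5 * x)) ≤ Real.exp (-(4 * x)) := by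
    calc _ ≤ Real.exp x * Real.exp (-(5 * x)) :=
          mul_le_mul_of_nonneg_right hxe (Real.exp_pos _).le
      _ = _ := by rw [← Real.exp_add]; congr 1; ring
  have h3 : (n + 2 : ℕ) * Real.exp (-(5 * x)) ^ 2 / e ≤ Real.exp (-(4 * x)) := by
    rw [div_le_iff₀ he]
    have h4 : Real.exp (-(4 * x)) * Real.exp (-x) ≤ Real.exp (-(4 * x)) * e :=
      mul_le_mul_of_nonneg_left (hxh.trans H.mul_le) (Real.exp_pos _).le
    refine le_trans ?_ h4
    rw [sq, ← mul_assoc]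
    refine mul_le_mul h2 (Real.exp_le_exp.2 (by linarith)) (Real.exp_pos _).le (Real.exp_pos _).le
  have h5 : Real.exp (-(3 * x)) = Real.exp (-(4 * x)) * Real.exp x := by
    rw [← Real.exp_add]; congr 1; ring
  have h6 : 3 ≤ Real.exp x := by linarith [Real.add_one_le_exp x]
  rw [h5]
  nlinarith [Real.exp_pos (-(4 * x))]

end NormalizedSpectrum

/-! ### Conjugation of SAM to the normalized map. -/

section Conjugation

variable {n : ℕ}

theorem gradient_quadLoss {d : ℕ} (lam : Fin d → ℝ) (w : EuclideanSpace ℝ (Fin d)) :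
    gradient (quadLoss lam) w = WithLp.toLp 2 fun i => lam i * w i := by
  have hfun : quadLoss lam = fun w : EuclideanSpace ℝ (Fin d) => ∑ i, lam i / 2 * w i ^ 2 := by
    funext w
    simp only [quadLoss, dotProduct, Matrix.mulVec_diagonal, Finset.mul_sum]
    exact Finset.sum_congr rfl fun i _ => by ring
  have hder : HasFDerivAt (quadLoss lam)
      (∑ i, (lam i * w i) • (EuclideanSpace.proj i : EuclideanSpace ℝ (Fin d) →L[ℝ] ℝ)) w := by
    rw [hfun]
    refine HasFDerivAt.fun_sum fun i _ => ?_
    have := (((EuclideanSpace.proj i : EuclideanSpace ℝ (Fin d) →L[ℝ] ℝ).hasFDerivAt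
      (x := w)).pow 2).const_mul (lam i / 2)
    refine this.congr_fderiv ?_
    ext v
    simp
    ring
  have hg : HasGradientAt (quadLoss lam) (WithLp.toLp 2 fun i => lam i * w i) w := by
    rw [hasGradientAt_iff_hasFDerivAt]
    refine hder.congr_fderiv ?_
    ext v
    rw [InnerProductSpace.toDual_apply_apply, inner_eq_sum_mul]
    simp
  exact hg.gradient

/-- Rescaled gradient coordinates. -/
noncomputable def gradChart (lam : Fin (n + 2) → ℝ) (η ρ : ℝ) (w : EuclideanSpace ℝ (Fin (n + 2))) :
    EuclideanSpace ℝ (Fin (n + 2)) :=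
  WithLp.toLp 2 fun i => lam i / lam 0 / (η * ρ * lam 0) * w i

@[simp] theorem gradChart_apply (lam : Fin (n + 2) → ℝ) (η ρ : ℝ)
    (w : EuclideanSpace ℝ (Fin (n + 2))) (i : Fin (n + 2)) :
    gradChart lam η ρ w i = lam i / lam 0 / (η * ρ * lam 0) * w i := rfl

theorem gradChart_sub (lam : Fin (n + 2) → ℝ) (η ρ : ℝ) (w z : EuclideanSpace ℝ (Fin (n + 2))) :
    gradChart lam η ρ (w - z) = gradChart lam η ρ w - gradChart lam η ρ z := by
  ext i
  simp [mul_sub]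

theorem gradChart_smul (lam : Fin (n + 2) → ℝ) (η ρ c : ℝ) (w : EuclideanSpace ℝ (Fin (n + 2))) :
    gradChart lam η ρ (c • w) = c • gradChart lam η ρ w := by
  ext i
  simp [mul_left_comm]

variable {lam : Fin (n + 2) → ℝ} {η ρ : ℝ}

theorem gradChart_samStep (h0 : 0 < lam 0) (hη : 0 < η) (hρ : 0 < ρ)
    (w : EuclideanSpace ℝ (Fin (n + 2))) :
    gradChart lam η ρ (samStep (quadLoss lam) η ρ w) =
      -samMap (fun i => lam i / lam 0) (η * lam 0) (gradChart lam η ρ w) := by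
  have hgr : gradient (quadLoss lam) w = (η * ρ * lam 0 * lam 0) • gradChart lam η ρ w := by
    rw [gradient_quadLoss]
    ext i
    simp only [PiLp.smul_apply, smul_eq_mul, gradChart_apply]
    field_simp
  have hn : ‖gradient (quadLoss lam) w‖ = (η * ρ * lam 0 * lam 0) * ‖gradChart lam η ρ w‖ := by
    rw [hgr, norm_smul, Real.norm_of_nonneg (by positivity)]
  ext i
  rw [gradChart_apply, samStep, hn, gradient_quadLoss, gradient_quadLoss]
  simp only [PiLp.sub_apply, PiLp.add_apply, PiLp.neg_apply, PiLp.smul_apply, smul_eq_mul, NormalizedSpectrum.samMap_apply, growth,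
    gradChart_apply, div_eq_mul_inv, mul_inv]
  generalize ‖gradChart lam η ρ w‖⁻¹ = b
  field_simp
  ring

theorem samMap_smul_of_abs_eq_one {l : Fin (n + 2) → ℝ} {e c : ℝ} (hc : |c| = 1)
    (u : EuclideanSpace ℝ (Fin (n + 2))) : samMap l e (c • u) = c • samMap l e u := by
  ext i
  simp [norm_smul, hc, mul_assoc]

theorem gradChart_samIter (h0 : 0 < lam 0) (hη : 0 < η) (hρ : 0 < ρ)
    (w : EuclideanSpace ℝ (Fin (n + 2))) (t : ℕ) :
    gradChart lam η ρ (samIter (quadLoss lam) η ρ w t) =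
      ((-1 : ℝ) ^ t) • (samMap (fun i => lam i / lam 0) (η * lam 0))^[t] (gradChart lam η ρ w) := by
  induction t with
  | zero => simp [samIter]
  | succ t ih =>
    rw [samIter, gradChart_samStep h0 hη hρ, ih, samMap_smul_of_abs_eq_one (by simp),
      Function.iterate_succ_apply', pow_succ]
    simp

theorem gradChart_cyclePoint (h0 : 0 < lam 0) (hη : 0 < η) (hρ : 0 < ρ) :
    gradChart lam η ρ (cyclePoint lam η ρ) =
      (1 / (2 - η * lam 0)) • EuclideanSpace.single (0 : Fin (n + 2)) (1 : ℝ) := by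
  ext i
  simp only [gradChart_apply, cyclePoint, PiLp.smul_apply, smul_eq_mul, PiLp.single_apply]
  split_ifs with h
  · subst h
    field_simp
  · simp

theorem norm_gradChart_le (hlam : Antitone lam) (hd : 0 < lam (Fin.last (n + 1))) (hη : 0 < η)
    (hρ : 0 < ρ) (w : EuclideanSpace ℝ (Fin (n + 2))) :
    ‖gradChart lam η ρ w‖ ≤ 1 / (η * ρ * lam 0) * ‖w‖ := by
  have hpos : ∀ i, 0 < lam i := fun i => hd.trans_le (hlam (Fin.le_last i))
  have h0 := hpos 0
  refine norm_le_mul_of_forall_abs_le (by positivity) fun i => ?_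
  have hi := hpos i
  rw [gradChart_apply, abs_mul,
    abs_of_pos (show 0 < lam i / lam 0 / (η * ρ * lam 0) by positivity)]
  refine mul_le_mul_of_nonneg_right (div_le_div_of_nonneg_right ?_ (by positivity)) (abs_nonneg _)
  exact div_le_one_of_le₀ (hlam (Fin.zero_le i)) h0.le

theorem mul_norm_le_norm_gradChart (hlam : Antitone lam) (hd : 0 < lam (Fin.last (n + 1)))
    (hη : 0 < η) (hρ : 0 < ρ) (w : EuclideanSpace ℝ (Fin (n + 2))) :
    lam (Fin.last (n + 1)) / lam 0 / (η * ρ * lam 0) * ‖w‖ ≤ ‖gradChart lam η ρ w‖ := by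
  have hpos : ∀ i, 0 < lam i := fun i => hd.trans_le (hlam (Fin.le_last i))
  have h0 := hpos 0
  refine mul_norm_le_of_forall_le_abs (by positivity) fun i => ?_
  have hi := hpos i
  rw [gradChart_apply, abs_mul,
    abs_of_pos (show 0 < lam i / lam 0 / (η * ρ * lam 0) by positivity)]
  refine mul_le_mul_of_nonneg_right ?_ (abs_nonneg _)
  have := hlam (Fin.le_last i)
  gcongr

end Conjugation

/-! ### Probability of resonance. -/

section Probability

theorem HasDensityAtMost.measure_le {d : ℕ} {μ : Measure (EuclideanSpace ℝ (Fin d))} {A : ℝ}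
    (h : HasDensityAtMost μ A) (s : Set (EuclideanSpace ℝ (Fin d))) :
    μ s ≤ ENNReal.ofReal A * volume s := by
  obtain ⟨f, -, hfA, rfl⟩ := h
  have := withDensity_mono (μ := (volume : Measure (EuclideanSpace ℝ (Fin d))))
    (f := f) (g := fun _ => ENNReal.ofReal A) (Filter.Eventually.of_forall hfA)
  rw [withDensity_const] at this
  exact this s

theorem HasDensityAtMost.pos {d : ℕ} {μ : Measure (EuclideanSpace ℝ (Fin d))}
    [IsProbabilityMeasure μ] {A : ℝ} (h : HasDensityAtMost μ A) : 0 < A := by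
  by_contra hA
  have := h.measure_le Set.univ
  rw [ENNReal.ofReal_of_nonpos (not_lt.1 hA), zero_mul, measure_univ] at this
  exact absurd this (by simp)

variable {n : ℕ} {lam : Fin (n + 2) → ℝ} {η ρ : ℝ}

theorem volume_gradChart_resonantSet_le (hlam : Antitone lam) (hd : 0 < lam (Fin.last (n + 1)))
    (hη : 0 < η) (hρ : 0 < ρ) {r : ℝ}
    (H : NormalizedSpectrum (fun i => lam i / lam 0) (η * lam 0)
      (lam (Fin.last (n + 1)) / lam 0) r)
    {τ : ℝ} (hτ0 : 0 < τ) (hτ1 : τ ≤ 1) (t : ℕ) :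
    volume {w | gradChart lam η ρ w ∈ NormalizedSpectrum.resonantSet (fun i => lam i / lam 0)
      (η * lam 0) (lam (Fin.last (n + 1)) / lam 0) τ t} ≤
    ENNReal.ofReal (1 / (((η * lam 0 * (lam (Fin.last (n + 1)) / lam 0)) ^ 3) ^ t *
      (lam (Fin.last (n + 1)) / lam 0 / (η * ρ * lam 0))) ^ (n + 2) *
      (τ * ((n + 2 : ℕ) * 6 ^ (n + 2)))) := by
  have h0 : 0 < lam 0 := hd.trans_le (hlam (Fin.le_last 0))
  have hc : 0 < ((η * lam 0 * (lam (Fin.last (n + 1)) / lam 0)) ^ 3) ^ t *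
      (lam (Fin.last (n + 1)) / lam 0 / (η * ρ * lam 0)) := by positivity
  rw [ENNReal.ofReal_mul (by positivity)]
  refine (volume_le_of_antilipschitzOn (f := fun w =>
    (samMap (fun i => lam i / lam 0) (η * lam 0))^[t] (gradChart lam η ρ w)) hc ?_).trans ?_
  · intro w hw z hz
    refine le_trans ?_ (H.iterate_antilipschitz hw.1 hz.1)
    rw [mul_assoc, ← gradChart_sub]
    exact mul_le_mul_of_nonneg_left (mul_norm_le_norm_gradChart hlam hd hη hρ _)
      (pow_nonneg (pow_nonneg H.mul_pos.le 3) t)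
  · refine mul_le_mul_right ?_ _
    have he := H.e_lt
    have he0 := H.e_pos
    refine (measure_mono ?_).trans (volume_shell_le (θ := 1 / (1 - η * lam 0)) hτ0 hτ1 ?_ ?_)
    · rintro _ ⟨w, hw, rfl⟩
      exact hw.2
    · rw [le_div_iff₀ (by linarith)]; linarith
    · rw [div_le_iff₀ (by linarith)]; linarith

/-- Since `1 / h ≤ exp x` and the dimension is at most `x`, pulling the shell back costs at most `R
^ (n + 2) * exp (x ^ 2 * (3 * T + 1))`. The width `exp (-4 * x ^ 2 * (T + 1))` beats this with room
for `A`, `6 ^ (n + 2)` and the factor `T` of the union bound. -/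
theorem resonant_term_le {x h L s R A δ : ℝ} {T t : ℕ} (hx2 : 2 ≤ x)
    (hxn : ((n + 2 : ℕ) : ℝ) ≤ x) (hh : Real.exp (-x) ≤ h) (hL : Real.exp (-x) ≤ L) (hs : 0 < s)
    (hsR : s ≤ R) (hA : 0 < A) (hδ : 0 < δ)
    (hy : Real.exp (-x) ≤ δ * (1 / (2 ^ (n + 3) * A * R ^ (n + 2)))) (ht : t < T) :
    A * (1 / ((h ^ 3) ^ t * (L / s)) ^ (n + 2) *
      (Real.exp (-(4 * x ^ 2 * (T + 1))) * ((n + 2 : ℕ) * 6 ^ (n + 2)))) ≤ δ / 2 / T := by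
  have hR : 0 < R := hs.trans_le hsR
  have hT : (0 : ℝ) < T := by exact_mod_cast (Nat.zero_le t).trans_lt ht
  have hT1 : (t : ℝ) ≤ T := by exact_mod_cast ht.le
  have hexn := Real.exp_pos (-x)
  have hh0 := hexn.trans_le hh
  have hL0 := hexn.trans_le hL
  have hAR : A * R ^ (n + 2) ≤ δ / 2 * Real.exp x * (1 / 2 ^ (n + 2)) := by
    rw [mul_one_div, le_div_iff₀ (by positivity), Real.exp_neg, inv_mul_le_iff₀ (Real.exp_pos x),
      mul_comm (Real.exp x)] at hy
    have : 2 ^ (n + 3) * A * R ^ (n + 2) ≤ δ * Real.exp x := hy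
    rw [mul_one_div, le_div_iff₀ (by positivity)]
    rw [pow_succ (2 : ℝ) (n + 2)] at this
    linarith
  have hinv : 1 / ((h ^ 3) ^ t * (L / s)) ≤ R * Real.exp (x * (3 * T + 1)) := by
    rw [div_le_iff₀ (by positivity)]
    have h1 : Real.exp (-(x * (3 * T))) ≤ (h ^ 3) ^ t := by
      rw [← pow_mul]
      calc Real.exp (-(x * (3 * T))) ≤ Real.exp (-(x * (3 * t))) :=
            Real.exp_le_exp.2 (by nlinarith)
        _ = Real.exp (-x) ^ (3 * t) := by
            rw [← Real.exp_nat_mul]; congr 1; push_cast; ring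
        _ ≤ _ := pow_le_pow_left₀ hexn.le hh _
    have h2 : Real.exp (-x) / R ≤ L / s := div_le_div₀ hL0.le hL hs hsR
    calc (1 : ℝ) = R * Real.exp (x * (3 * T + 1)) * (Real.exp (-(x * (3 * T))) * (Real.exp (-x) / R)) := by
          rw [show R * Real.exp (x * (3 * T + 1)) * (Real.exp (-(x * (3 * T))) * (Real.exp (-x) / R))
            = (R / R) * (Real.exp (x * (3 * T + 1)) * Real.exp (-(x * (3 * T))) * Real.exp (-x)) by
              ring, div_self hR.ne', ← Real.exp_add, ← Real.exp_add, one_mul,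
            show x * (3 * T + 1) + -(x * (3 * T)) + -x = 0 by ring, Real.exp_zero]
      _ ≤ _ := by gcongr
  have hpow : 1 / ((h ^ 3) ^ t * (L / s)) ^ (n + 2) ≤
      R ^ (n + 2) * Real.exp (x ^ 2 * (3 * T + 1)) := by
    rw [← one_div_pow]
    refine (pow_le_pow_left₀ (by positivity) hinv _).trans ?_
    rw [mul_pow, ← Real.exp_nat_mul]
    refine mul_le_mul_of_nonneg_left (Real.exp_le_exp.2 ?_) (by positivity)
    calc ((n + 2 : ℕ) : ℝ) * (x * (3 * T + 1)) ≤ x * (x * (3 * T + 1)) :=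
          mul_le_mul_of_nonneg_right hxn (by positivity)
      _ = _ := by ring
  have h3n : (3 : ℝ) ^ (n + 2) ≤ Real.exp (2 * x) := by
    have : (3 : ℝ) ≤ Real.exp 2 := by linarith [Real.add_one_le_exp (2 : ℝ)]
    refine (pow_le_pow_left₀ (by norm_num) this _).trans ?_
    rw [← Real.exp_nat_mul]
    exact Real.exp_le_exp.2 (by linarith)
  have hn : ((n + 2 : ℕ) : ℝ) ≤ Real.exp x := by linarith [Real.add_one_le_exp x]
  have hTe : (T : ℝ) ≤ Real.exp T := by linarith [Real.add_one_le_exp (T : ℝ)]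
  rw [le_div_iff₀ hT]
  set τ := Real.exp (-(4 * x ^ 2 * (T + 1))) with hτ
  calc A * (1 / ((h ^ 3) ^ t * (L / s)) ^ (n + 2) * (τ * ((n + 2 : ℕ) * 6 ^ (n + 2)))) * T
      ≤ A * (R ^ (n + 2) * Real.exp (x ^ 2 * (3 * T + 1)) *
          (τ * ((n + 2 : ℕ) * 6 ^ (n + 2)))) * T := by
        have : 0 < τ := Real.exp_pos _
        gcongr
    _ = A * R ^ (n + 2) * (Real.exp (x ^ 2 * (3 * T + 1)) *
          (τ * ((n + 2 : ℕ) * 6 ^ (n + 2))) * T) := by ring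
    _ ≤ δ / 2 * Real.exp x * (1 / 2 ^ (n + 2)) * (Real.exp (x ^ 2 * (3 * T + 1)) *
          (τ * ((n + 2 : ℕ) * 6 ^ (n + 2))) * T) := by
        have : 0 < τ := Real.exp_pos _
        gcongr
    _ = δ / 2 * (Real.exp x * Real.exp (x ^ 2 * (3 * T + 1)) * τ * (n + 2 : ℕ) *
          3 ^ (n + 2) * T) := by
        rw [show (6 : ℝ) ^ (n + 2) = 2 ^ (n + 2) * 3 ^ (n + 2) by rw [← mul_pow]; norm_num]
        field_simp
    _ ≤ δ / 2 * (Real.exp x * Real.exp (x ^ 2 * (3 * T + 1)) * τ * Real.exp x *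
          Real.exp (2 * x) * Real.exp T) := by
        have : 0 < τ := Real.exp_pos _
        gcongr
    _ = δ / 2 * Real.exp (x + x ^ 2 * (3 * T + 1) + -(4 * x ^ 2 * (T + 1)) + x + 2 * x + T) := by
        rw [hτ, ← Real.exp_add, ← Real.exp_add, ← Real.exp_add, ← Real.exp_add, ← Real.exp_add]
    _ ≤ δ / 2 * Real.exp 0 := by
        refine mul_le_mul_of_nonneg_left (Real.exp_le_exp.2 ?_) (by positivity)
        have h1 : 4 * x ≤ 2 * x ^ 2 := by nlinarith
        have h2 : (T : ℝ) ≤ x ^ 2 * T := le_mul_of_one_le_left hT.le (by nlinarith)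
        nlinarith
    _ = δ / 2 := by rw [Real.exp_zero, mul_one]

end Probability

/-! ### Rates and total time in the original parameters. -/

section Normalization

variable {n : ℕ} {lam : Fin (n + 2) → ℝ} {η : ℝ}

theorem normalizedSpectrum_of_antitone (hlam : Antitone lam) (hgap : lam 1 < lam 0)
    (hd : 0 < lam (Fin.last (n + 1))) (hη : 0 < η) (hη2 : η < 1 / (2 * lam 0)) :
    NormalizedSpectrum (fun i => lam i / lam 0) (η * lam 0) (lam (Fin.last (n + 1)) / lam 0)
      (min (η * lam (Fin.last (n + 1))) (lam 0 ^ 2 / lam 1 ^ 2 - 1) / 2) := by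
  have hpos : ∀ i, 0 < lam i := fun i => hd.trans_le (hlam (Fin.le_last i))
  have h0 := hpos 0
  have h1 := hpos 1
  have hη3 : η * lam 0 < 1 / 2 := by
    rw [lt_div_iff₀ (by positivity)] at hη2
    linarith
  have hg : 0 < lam 0 ^ 2 / lam 1 ^ 2 - 1 := by
    rw [sub_pos, one_lt_div (by positivity)]
    exact pow_lt_pow_left₀ hgap h1.le (by norm_num)
  have hmul : η * lam 0 * (lam (Fin.last (n + 1)) / lam 0) = η * lam (Fin.last (n + 1)) := by
    field_simp
  have hdh : η * lam (Fin.last (n + 1)) ≤ η * lam 0 :=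
    mul_le_mul_of_nonneg_left (hlam (Fin.le_last 0)) hη.le
  set g := lam 0 ^ 2 / lam 1 ^ 2 - 1 with hg_def
  set m := min (η * lam (Fin.last (n + 1))) g with hm
  have hm0 : 0 < m := lt_min (by positivity) hg
  have hmg : m ≤ g := min_le_right _ _
  have hmh : m ≤ η * lam (Fin.last (n + 1)) := min_le_left _ _
  refine ⟨div_self h0.ne', fun i => ?_, fun i => ?_, by positivity, by positivity, hη3,
    by positivity, ?_, fun i hi => ?_⟩
  · exact div_le_div_of_nonneg_right (hlam (Fin.le_last i)) h0.le
  · exact div_le_one_of_le₀ (hlam (Fin.zero_le i)) h0.le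
  · rw [hmul]; linarith
  · have hi1 : lam i ≤ lam 1 := hlam (Fin.one_le_of_ne_zero hi)
    have h2 : (lam i / lam 0) ^ 2 ≤ (lam 1 / lam 0) ^ 2 :=
      pow_le_pow_left₀ (div_pos (hpos i) h0).le (div_le_div_of_nonneg_right hi1 h0.le) 2
    have h3 : (lam 1 / lam 0) ^ 2 = 1 / (1 + g) := by
      rw [hg_def, add_sub_cancel, div_pow, one_div_div]
    refine h2.trans ?_
    rw [h3, div_le_iff₀ (by linarith)]
    -- The claim is `1 ≤ (1 - m / 2) * (1 + g)`: for `g ≤ 1` it follows from `m ≤ g`, for `g ≥ 1`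
    -- from `m < 1 / 2`.
    rcases le_total g 1 with hg1 | hg1 <;> nlinarith

/-- Entry, alignment and final contraction together take at most a constant times `k ^ 2 * x ^ 3 /
(h * m)`, and `k ≥ 1` allows `k ^ 5`. -/
theorem total_time_le {x h L m : ℝ} {d : ℕ} (hx2 : 2 ≤ x) (hL0 : 0 < L) (hL1 : L ≤ 1)
    (hm0 : 0 < m) (hmh : m ≤ h) (hh : h < 1 / 2) :
    (x / h + 1) + ((21 * x ^ 2 / (h * L ^ 2) + 18 * x ^ 3 / h + 5 * x) / (m / 2) + 1 +
      (4 * x / h + 1)) ≤ ((1 / L) ^ 5 / (h * m) + d) * (100 * x ^ 3) := by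
  have hh0 : 0 < h := hm0.trans_le hmh
  set k := 1 / L with hk
  have hk1 : 1 ≤ k := by rw [hk, le_div_iff₀ hL0]; linarith
  set P := 1 / (h * m) with hP
  have hP0 : 0 < P := by positivity
  have hx3 : 0 < x ^ 3 := by positivity
  have hk5 : k ^ 2 ≤ k ^ 5 := pow_le_pow_right₀ hk1 (by norm_num)
  have hk15 : 1 ≤ k ^ 5 := one_le_pow₀ hk1
  have hhP : 1 / h ≤ P / 2 := by
    rw [hP, div_div, div_le_div_iff₀ hh0 (by positivity)]
    nlinarith
  have hP1 : 1 ≤ P / 4 := by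
    rw [hP, div_div, le_div_iff₀ (by positivity)]
    nlinarith
  have e1 : (21 * x ^ 2 / (h * L ^ 2) + 18 * x ^ 3 / h + 5 * x) / (m / 2) =
      42 * x ^ 2 * k ^ 2 * P + 36 * x ^ 3 * P + 10 * x * (h * P) := by
    rw [hP, hk]; field_simp; ring
  have e2 : k ^ 5 / (h * m) = k ^ 5 * P := by rw [hP, mul_one_div]
  have e3 : x / h = x * (1 / h) := by ring
  have e4 : 4 * x / h = 4 * x * (1 / h) := by ring
  rw [e1, e2, e3, e4]
  have hxx : x ^ 2 ≤ x ^ 3 / 2 := by nlinarith [sq_nonneg x]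
  have hxxx : x ≤ x ^ 3 / 4 := by nlinarith
  have a1 : 42 * x ^ 2 * k ^ 2 * P ≤ 21 * (k ^ 5 * P * x ^ 3) := by
    have : x ^ 2 * k ^ 2 ≤ x ^ 3 / 2 * k ^ 5 := mul_le_mul hxx hk5 (by positivity) (by positivity)
    nlinarith
  have hPk : P * x ^ 3 ≤ k ^ 5 * P * x ^ 3 := by
    have := mul_le_mul_of_nonneg_right hk15 (show 0 ≤ P * x ^ 3 by positivity)
    linarith
  have a2 : 10 * x * (h * P) ≤ 2 * (P * x ^ 3) := by
    have : x * (h * P) ≤ x ^ 3 / 4 * (1 / 2 * P) := by gcongr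
    linarith [mul_pos hP0 hx3]
  have a3 : x * (1 / h) ≤ P * x ^ 3 := by
    have : x * (1 / h) ≤ x ^ 3 / 4 * (P / 2) := by gcongr
    nlinarith [mul_pos hP0 hx3]
  have a4 : 3 ≤ P * x ^ 3 := by
    have : 1 * 8 ≤ P / 4 * x ^ 3 := mul_le_mul hP1 (by nlinarith) (by norm_num) (by positivity)
    linarith
  have a5 : 0 ≤ (d : ℝ) * (100 * x ^ 3) := by positivity
  nlinarith

end Normalization

/-! ### Convergence of the SAM iterates from a good initial point. -/

section Assembly

variable {n : ℕ} {lam : Fin (n + 2) → ℝ} {η ρ : ℝ}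

theorem norm_le_of_norm_gradChart_le (hlam : Antitone lam) (hd : 0 < lam (Fin.last (n + 1)))
    (hη : 0 < η) (hρ : 0 < ρ) {R B ε : ℝ} (hR : η * ρ * lam 0 ≤ R)
    (hBε : R * B ≤ ε * (lam (Fin.last (n + 1)) / lam 0)) (hB : 0 ≤ B)
    {w : EuclideanSpace ℝ (Fin (n + 2))} (hw : ‖gradChart lam η ρ w‖ ≤ B) : ‖w‖ ≤ ε := by
  have h0 : 0 < lam 0 := hd.trans_le (hlam (Fin.le_last 0))
  have h := (mul_norm_le_norm_gradChart hlam hd hη hρ w).trans hw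
  have hs : 0 < η * ρ * lam 0 := by positivity
  have hL : 0 < lam (Fin.last (n + 1)) / lam 0 := by positivity
  rw [div_mul_eq_mul_div, div_le_iff₀ hs] at h
  refine le_of_mul_le_mul_left ?_ hL
  nlinarith [mul_le_mul_of_nonneg_left hR hB]

/-- The SAM iterates stay in a ball, hence the claim is immediate for large tolerances. -/
theorem norm_samIter_add_le (hlam : Antitone lam) (hd : 0 < lam (Fin.last (n + 1)))
    (hη : 0 < η) (hρ : 0 < ρ) {r : ℝ}
    (H : NormalizedSpectrum (fun i => lam i / lam 0) (η * lam 0)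
      (lam (Fin.last (n + 1)) / lam 0) r)
    {R ε : ℝ} (hR : η * ρ * lam 0 < R) (hε : R / (η * lam (Fin.last (n + 1))) ≤ ε)
    {w : EuclideanSpace ℝ (Fin (n + 2))} (hw : ‖w‖ ≤ R) (t : ℕ) {c : ℝ} (hc : |c| = 1) :
    ‖samIter (quadLoss lam) η ρ w t + c • cyclePoint lam η ρ‖ ≤ ε := by
  have h0 : 0 < lam 0 := hd.trans_le (hlam (Fin.le_last 0))
  have hs : 0 < η * ρ * lam 0 := by positivity
  have hR0 : 0 < R := hs.trans hR
  have hRs : 1 ≤ R / (η * ρ * lam 0) := by rw [le_div_iff₀ hs]; linarith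
  have hu : ‖gradChart lam η ρ w‖ ≤ R / (η * ρ * lam 0) := by
    refine (norm_gradChart_le hlam hd hη hρ w).trans ?_
    rw [div_eq_inv_mul R, one_div]
    exact mul_le_mul_of_nonneg_left hw (by positivity)
  have hit : ‖gradChart lam η ρ (samIter (quadLoss lam) η ρ w t)‖ ≤ R / (η * ρ * lam 0) := by
    rw [gradChart_samIter h0 hη hρ, norm_smul]
    simp only [norm_pow, norm_neg, norm_one, one_pow, one_mul]
    refine (H.norm_iterate_le _ t).trans (max_le hRs ?_)
    refine (mul_le_of_le_one_left (norm_nonneg _) ?_).trans hu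
    exact pow_le_one₀ (by linarith [H.mul_lt_half]) (by linarith [H.mul_pos])
  have hV : ‖gradChart lam η ρ (cyclePoint lam η ρ)‖ ≤ 1 := by
    have := H.e_lt
    rw [gradChart_cyclePoint h0 hη hρ, norm_smul, PiLp.norm_single, norm_one, mul_one,
      Real.norm_of_nonneg (one_div_nonneg.2 (by linarith)), div_le_one₀ (by linarith)]
    linarith
  have hsum : ‖gradChart lam η ρ (samIter (quadLoss lam) η ρ w t + c • cyclePoint lam η ρ)‖ ≤
      2 * (R / (η * ρ * lam 0)) := by
    rw [show samIter (quadLoss lam) η ρ w t + c • cyclePoint lam η ρ =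
      samIter (quadLoss lam) η ρ w t - (-c) • cyclePoint lam η ρ by rw [neg_smul, sub_neg_eq_add],
      gradChart_sub, gradChart_smul]
    refine (norm_sub_le _ _).trans ?_
    rw [norm_smul, norm_neg, Real.norm_eq_abs, hc, one_mul]
    linarith
  refine norm_le_of_norm_gradChart_le hlam hd hη hρ le_rfl ?_ (by positivity) hsum
  rw [mul_left_comm, mul_div_cancel₀ _ hs.ne']
  have hh := H.mul_lt_half
  rw [div_le_iff₀ (by positivity)] at hε
  have he := H.e_lt
  have hεpos : 0 < ε := by
    by_contra h
    have : ε * (η * lam (Fin.last (n + 1))) ≤ 0 :=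
      mul_nonpos_of_nonpos_of_nonneg (not_lt.1 h) (by positivity)
    linarith
  have hL : 0 < lam (Fin.last (n + 1)) / lam 0 := by positivity
  have e1 : η * lam (Fin.last (n + 1)) = (η * lam 0) * (lam (Fin.last (n + 1)) / lam 0) := by
    field_simp
  rw [e1] at hε
  nlinarith [mul_pos hεpos hL]

theorem samIter_near_cycle (hlam : Antitone lam) (hgap : lam 1 < lam 0)
    (hd : 0 < lam (Fin.last (n + 1))) (hη : 0 < η) (hη2 : η < 1 / (2 * lam 0)) (hρ : 0 < ρ)
    {x R : ℝ} (hx2 : 2 ≤ x) (hxn : ((n + 2 : ℕ) : ℝ) ≤ x)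
    (hxh : Real.exp (-x) ≤ η * lam (Fin.last (n + 1))) (hR : η * ρ * lam 0 < R)
    (hRx : R ≤ Real.exp x) (hRs : R / (η * ρ * lam 0) ≤ Real.exp x)
    {w : EuclideanSpace ℝ (Fin (n + 2))} (hw : ‖w‖ ≤ R) (hw0 : R * Real.exp (-x) ≤ |w 0|)
    {T : ℕ} (hTdef : T = ⌈x / (η * lam (Fin.last (n + 1)))⌉₊)
    (hres : ∀ t < T, gradChart lam η ρ w ∉ NormalizedSpectrum.resonantSet
      (fun i => lam i / lam 0) (η * lam 0) (lam (Fin.last (n + 1)) / lam 0)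
      (Real.exp (-(4 * x ^ 2 * (T + 1)))) t)
    {t : ℕ} (ht : timeFactor lam η * (100 * x ^ 3) ≤ t) :
    (‖samIter (quadLoss lam) η ρ w t - cyclePoint lam η ρ‖ ≤ Real.exp (-x) ∧
      ‖samIter (quadLoss lam) η ρ w (t + 1) + cyclePoint lam η ρ‖ ≤ Real.exp (-x)) ∨
    (‖samIter (quadLoss lam) η ρ w t + cyclePoint lam η ρ‖ ≤ Real.exp (-x) ∧
      ‖samIter (quadLoss lam) η ρ w (t + 1) - cyclePoint lam η ρ‖ ≤ Real.exp (-x)) := by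
  have H := normalizedSpectrum_of_antitone hlam hgap hd hη hη2
  have h0 : 0 < lam 0 := hd.trans_le (hlam (Fin.le_last 0))
  have h1 : 0 < lam 1 := hd.trans_le (hlam (Fin.le_last 1))
  have hs : 0 < η * ρ * lam 0 := by positivity
  have hhe : η * lam 0 * (lam (Fin.last (n + 1)) / lam 0) = η * lam (Fin.last (n + 1)) := by
    field_simp
  have hh0 : 0 < η * lam (Fin.last (n + 1)) := by positivity
  have hhalf := H.mul_lt_half
  rw [hhe] at hhalf
  have hx0 : 0 < x := by linarith
  set u := gradChart lam η ρ w with hu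
  set G := samMap (fun i => lam i / lam 0) (η * lam 0) with hG
  set h := η * lam (Fin.last (n + 1)) with hh
  have hunorm : ‖u‖ ≤ Real.exp x := by
    refine ((norm_gradChart_le hlam hd hη hρ w).trans ?_).trans hRs
    rw [div_eq_inv_mul R, one_div]
    exact mul_le_mul_of_nonneg_left hw (by positivity)
  have hu0 : Real.exp (-x) ≤ |u 0| := by
    rw [hu, gradChart_apply, div_self h0.ne', abs_mul, abs_of_pos (by positivity), one_div,
      ← div_eq_inv_mul, le_div_iff₀ hs]
    refine le_trans ?_ hw0
    rw [mul_comm]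
    exact mul_le_mul_of_nonneg_right hR.le (Real.exp_pos _).le
  have hune : u 0 ≠ 0 := abs_pos.1 ((Real.exp_pos _).trans_le hu0)
  have hTle : x / h ≤ T := by rw [hTdef]; exact Nat.le_ceil _
  have hTlt : (T : ℝ) < x / h + 1 := by rw [hTdef]; exact Nat.ceil_lt_add_one (by positivity)
  have huT : ‖G^[T] u‖ ≤ 1 := by
    refine (H.norm_iterate_le u T).trans (max_le le_rfl ?_)
    rw [hhe]
    have h2 : (1 - h) ^ T ≤ Real.exp (-x) := by
      refine (pow_le_pow_left₀ (by linarith) (by linarith [Real.add_one_le_exp (-h)] :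
        1 - h ≤ Real.exp (-h)) T).trans ?_
      rw [← Real.exp_nat_mul]
      refine Real.exp_le_exp.2 ?_
      rw [div_le_iff₀ hh0] at hTle
      linarith
    calc (1 - h) ^ T * ‖u‖ ≤ Real.exp (-x) * Real.exp x :=
          mul_le_mul h2 hunorm (norm_nonneg _) (Real.exp_pos _).le
      _ = 1 := by rw [← Real.exp_add]; simp
  -- The losses are `exp (-x)` initially, `exp (-2xT)` over `T` steps, the resonance width, and `1 /
  -- 8 ≥ exp (-3)`; `x ≥ 2` absorbs them all.
  have huT0 : Real.exp (-(6 * x ^ 2 * (T + 1))) ≤ |G^[T] u 0| := by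
    have h2 := H.le_abs_leading_coord hune (Real.exp_pos _)
      (Real.exp_le_one_iff.2 (neg_nonpos.2 (by positivity))) hres
    refine le_trans ?_ h2
    rw [hhe]
    have h3 : Real.exp (-(2 * x * T)) ≤ (h ^ 2) ^ T := by
      rw [← pow_mul]
      refine le_trans (le_of_eq ?_) (pow_le_pow_left₀ (Real.exp_pos _).le hxh _)
      rw [← Real.exp_nat_mul]
      congr 1
      push_cast
      ring
    have h4 : Real.exp (-3) ≤ 1 / 8 := by
      rw [Real.exp_neg, one_div]
      refine inv_anti₀ (by norm_num) ?_
      have h5 : (2 : ℝ) ≤ Real.exp 1 := by linarith [Real.add_one_le_exp (1 : ℝ)]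
      have h6 : Real.exp 3 = Real.exp 1 ^ 3 := by rw [← Real.exp_nat_mul]; norm_num
      rw [h6]
      calc (8 : ℝ) = 2 ^ 3 := by norm_num
        _ ≤ _ := pow_le_pow_left₀ (by norm_num) h5 3
    calc Real.exp (-(6 * x ^ 2 * (T + 1))) ≤
          Real.exp (-x + -(2 * x * T) + (-(4 * x ^ 2 * (T + 1)) + -3)) := by
            refine Real.exp_le_exp.2 ?_
            have hT0 : (0 : ℝ) ≤ T := Nat.cast_nonneg T
            have h7 : x * 2 ≤ x * x := mul_le_mul_of_nonneg_left hx2 hx0.le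
            have h8 : x * 2 * T ≤ x * x * T := mul_le_mul_of_nonneg_right h7 hT0
            nlinarith
      _ = Real.exp (-x) * Real.exp (-(2 * x * T)) *
            (Real.exp (-(4 * x ^ 2 * (T + 1))) * Real.exp (-3)) := by
            rw [← Real.exp_add, ← Real.exp_add, ← Real.exp_add]
      _ ≤ |u 0| * (h ^ 2) ^ T * (Real.exp (-(4 * x ^ 2 * (T + 1))) * (1 / 8)) := by gcongr
      _ = _ := by ring
  have hT3 : (T : ℝ) + 1 ≤ 3 * x / h := by
    have h2 : 2 ≤ 2 * x / h := by rw [le_div_iff₀ hh0]; nlinarith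
    have h3 : 3 * x / h = x / h + 2 * x / h := by ring
    linarith
  obtain ⟨σ, hσ, hconv⟩ := H.exists_sign_norm_iterate_sub_le hx2 (by rwa [hhe]) hxn
    (T := T + 1) (by rwa [hhe]) huT huT0
  rw [hhe] at hconv
  have hg : 0 < lam 0 ^ 2 / lam 1 ^ 2 - 1 := by
    rw [sub_pos, one_lt_div (by positivity)]
    exact pow_lt_pow_left₀ hgap h1.le (by norm_num)
  have htime := total_time_le (d := n + 2) hx2 H.pos H.L_le_one
    (lt_min hh0 hg) (min_le_left h _) hhalf
  rw [one_div_div] at htime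
  have htime' := htime.trans ht
  have hb0 : 0 ≤ (21 * x ^ 2 / (h * (lam (Fin.last (n + 1)) / lam 0) ^ 2) + 18 * x ^ 3 / h + 5 * x) /
      (min h (lam 0 ^ 2 / lam 1 ^ 2 - 1) / 2) := by
    have hm : 0 < min h (lam 0 ^ 2 / lam 1 ^ 2 - 1) := lt_min hh0 hg
    positivity
  have hb1 : 0 ≤ 4 * x / h := by positivity
  have hTt : T ≤ t := by
    have : (T : ℝ) ≤ t := by linarith
    exact_mod_cast this
  obtain ⟨k, rfl⟩ := Nat.exists_eq_add_of_le' hTt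
  push_cast at htime'
  have hk0 := hconv k (by linarith)
  have hk1 := hconv (k + 1) (by push_cast; linarith)
  rw [← Function.iterate_add_apply] at hk0 hk1
  -- Leaving the chart costs at most `R * λ₁ / λ_d ≤ exp (2x)`, hence the precision `exp (-3x)`. The
  -- sign `c` absorbs `(-1) ^ j`, so consecutive times meet opposite cycle points.
  have hfinal : ∀ (c : ℝ) (j : ℕ), (-1 : ℝ) ^ j * c = σ →
      ‖G^[j] u - (σ * (1 / (2 - η * lam 0))) •
        EuclideanSpace.single (0 : Fin (n + 2)) (1 : ℝ)‖ ≤ Real.exp (-(3 * x)) →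
      ‖samIter (quadLoss lam) η ρ w j - c • cyclePoint lam η ρ‖ ≤ Real.exp (-x) := by
    intro c j hc hj
    refine norm_le_of_norm_gradChart_le hlam hd hη hρ hR.le ?_ (Real.exp_pos (-(3 * x))).le ?_
    · have hLx : Real.exp (-x) ≤ lam (Fin.last (n + 1)) / lam 0 := by
        refine hxh.trans ?_
        rw [← hhe]
        exact mul_le_of_le_one_left H.pos.le (by linarith [H.e_lt])
      calc R * Real.exp (-(3 * x)) ≤ Real.exp x * Real.exp (-(3 * x)) :=
            mul_le_mul_of_nonneg_right hRx (Real.exp_pos _).le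
        _ = Real.exp (-x) * Real.exp (-x) := by
            rw [← Real.exp_add, ← Real.exp_add]; congr 1; ring
        _ ≤ _ := mul_le_mul_of_nonneg_left hLx (Real.exp_pos _).le
    · rw [gradChart_sub, gradChart_smul, gradChart_samIter h0 hη hρ, gradChart_cyclePoint h0 hη hρ]
      have hcc : c = (-1 : ℝ) ^ j * σ := by
        rw [← hc, ← mul_assoc, ← mul_pow]; simp
      rw [hcc, mul_smul, ← smul_sub, norm_smul]
      simp only [norm_pow, norm_neg, norm_one, one_pow, one_mul]
      rwa [← mul_smul]
  have hc1 : ((-1 : ℝ) ^ (k + T) * σ = 1) ∨ ((-1 : ℝ) ^ (k + T) * σ = -1) := by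
    rcases neg_one_pow_eq_or ℝ (k + T) with h2 | h2 <;> rcases hσ with h3 | h3 <;> simp [h2, h3]
  have hsq : (-1 : ℝ) ^ (k + T) * ((-1 : ℝ) ^ (k + T) * σ) = σ := by
    rw [← mul_assoc, ← mul_pow]; simp
  have hA := hfinal ((-1 : ℝ) ^ (k + T) * σ) (k + T) hsq hk0
  have hB := hfinal (-((-1 : ℝ) ^ (k + T) * σ)) (k + T + 1)
    (by rw [pow_succ]; linarith) (by rwa [add_right_comm] at hk1)
  rcases hc1 with hc | hc <;> rw [hc] at hA hB
  · left
    simpa using And.intro hA hB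
  · right
    simpa using And.intro hA hB

end Assembly

/-! ### The exceptional set. -/

section Probability

variable {n : ℕ} {lam : Fin (n + 2) → ℝ} {η ρ : ℝ}

/-- The exceptional initial points have small probability. -/
theorem measure_exceptional_le (hlam : Antitone lam) (hgap : lam 1 < lam 0)
    (hd : 0 < lam (Fin.last (n + 1))) (hη : 0 < η) (hη2 : η < 1 / (2 * lam 0)) (hρ : 0 < ρ)
    {x R A δ : ℝ} (hx2 : 2 ≤ x) (hxn : ((n + 2 : ℕ) : ℝ) ≤ x)
    (hxh : Real.exp (-x) ≤ η * lam (Fin.last (n + 1))) (hR : η * ρ * lam 0 < R) (hδ : 0 < δ)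
    {μ : Measure (EuclideanSpace ℝ (Fin (n + 2)))} [IsProbabilityMeasure μ]
    (hμ : HasDensityAtMost μ A)
    (hy : Real.exp (-x) ≤ δ * (1 / (2 ^ (n + 3) * A * R ^ (n + 2)))) {T : ℕ} (hT : 0 < T) :
    μ ({w | ‖w‖ ≤ R ∧ |w 0| ≤ R * Real.exp (-x)} ∪ ⋃ t ∈ Finset.range T,
      {w | gradChart lam η ρ w ∈ NormalizedSpectrum.resonantSet
        (fun i => lam i / lam 0) (η * lam 0) (lam (Fin.last (n + 1)) / lam 0)
        (Real.exp (-(4 * x ^ 2 * (T + 1)))) t}) ≤ ENNReal.ofReal δ := by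
  have H := normalizedSpectrum_of_antitone hlam hgap hd hη hη2
  have h0 : 0 < lam 0 := hd.trans_le (hlam (Fin.le_last 0))
  have hA := hμ.pos
  have hs : 0 < η * ρ * lam 0 := by positivity
  have hR0 : 0 < R := hs.trans hR
  have hhe : η * lam 0 * (lam (Fin.last (n + 1)) / lam 0) = η * lam (Fin.last (n + 1)) := by
    field_simp
  have hxL : Real.exp (-x) ≤ lam (Fin.last (n + 1)) / lam 0 := by
    refine hxh.trans ?_
    rw [← hhe]
    exact mul_le_of_le_one_left H.pos.le (by linarith [H.e_lt])
  have hT' : (0 : ℝ) < T := by exact_mod_cast hT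
  -- Half of `δ` goes to the slab, the other half is shared equally by the `T` resonant sets.
  have hslab : μ {w | ‖w‖ ≤ R ∧ |w 0| ≤ R * Real.exp (-x)} ≤ ENNReal.ofReal (δ / 2) := by
    refine (hμ.measure_le _).trans ((mul_le_mul_right
      (volume_slab_le (by positivity) hR0.le) _).trans ?_)
    rw [← ENNReal.ofReal_mul hA.le]
    refine ENNReal.ofReal_le_ofReal ?_
    rw [mul_one_div, le_div_iff₀ (by positivity)] at hy
    have e1 : A * (2 * (R * Real.exp (-x)) * (2 * R) ^ (n + 1)) =
        Real.exp (-x) * (2 ^ (n + 3) * A * R ^ (n + 2)) / 2 := by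
      rw [mul_pow]; ring
    linarith
  have hterm : ∀ t ∈ Finset.range T, μ {w | gradChart lam η ρ w ∈ NormalizedSpectrum.resonantSet
        (fun i => lam i / lam 0) (η * lam 0) (lam (Fin.last (n + 1)) / lam 0)
        (Real.exp (-(4 * x ^ 2 * (T + 1)))) t} ≤ ENNReal.ofReal (δ / 2 / T) := by
    intro t ht
    refine (hμ.measure_le _).trans ((mul_le_mul_right (volume_gradChart_resonantSet_le hlam hd hη hρ
      H (Real.exp_pos _) (Real.exp_le_one_iff.2 (neg_nonpos.2 (by positivity))) t) _).trans ?_)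
    rw [← ENNReal.ofReal_mul hA.le, hhe]
    exact ENNReal.ofReal_le_ofReal
      (resonant_term_le hx2 hxn hxh hxL hs hR.le hA hδ hy (Finset.mem_range.1 ht))
  refine (measure_union_le _ _).trans ?_
  refine (add_le_add hslab ((measure_biUnion_finset_le _ _).trans
    (Finset.sum_le_sum hterm))).trans ?_
  rw [Finset.sum_const, Finset.card_range, nsmul_eq_mul, ← ENNReal.ofReal_natCast,
    ← ENNReal.ofReal_mul (by positivity), mul_div_cancel₀ _ hT'.ne',
    ← ENNReal.ofReal_add (by positivity) (by positivity), add_halves]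

end Probability

/-! ### The tolerance bound and the final union bound. -/

/-- The bound on the tolerance, as a polynomial in
`1 / λ₁, λ_d, η, ρ, δ, 1 / ρ, 1 / A, 1 / R`. -/
noncomputable def toleranceBound (n : ℕ) : MvPolynomial (Fin 8) ℝ :=
  MvPolynomial.X 7 * (MvPolynomial.X 2 * MvPolynomial.X 1) *
    (MvPolynomial.C (Real.exp (-(n + 2 : ℕ)) / 2 ^ (n + 3)) *
      (MvPolynomial.X 2 * MvPolynomial.X 1) *
      (MvPolynomial.X 2 * MvPolynomial.X 1 * MvPolynomial.X 3 * MvPolynomial.X 7) *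
      MvPolynomial.X 4 * MvPolynomial.X 6 * MvPolynomial.X 7 ^ (n + 2)) ^ 2

theorem toleranceBound_pos (n : ℕ) {x : Fin 8 → ℝ} (hx : ∀ i, 0 < x i) :
    0 < MvPolynomial.eval x (toleranceBound n) := by
  have h1 := hx 1
  have h2 := hx 2
  have h3 := hx 3
  have h4 := hx 4
  have h6 := hx 6
  have h7 := hx 7
  simp only [toleranceBound, map_mul, map_pow, MvPolynomial.eval_X, MvPolynomial.eval_C]
  positivity

/-- Consequences of the tolerance bound that do not mention polynomials. -/
theorem tolerance_facts {n : ℕ} {ε h ρ R δ A : ℝ} (hε : 0 < ε) (hh : 0 < h) (hh2 : h < 1 / 2)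
    (hρ : 0 < ρ) (hR : h * ρ ≤ R) (hR0 : 0 < R) (hδ : 0 < δ) (hδ2 : δ ≤ 1 / 2) (hA : 0 < A)
    (hmass : 1 ≤ 2 ^ (n + 3) * A * R ^ (n + 2)) (hεR : ε < R / h)
    (hεp : ε < 1 / R * h * (Real.exp (-(n + 2 : ℕ)) / 2 ^ (n + 3) * h * (h * ρ * (1 / R)) * δ *
      (1 / A) * (1 / R) ^ (n + 2)) ^ 2) :
    ε ≤ Real.exp (-(n + 2 : ℕ)) ∧ ε ≤ h ∧ ε ≤ h * ρ / R ∧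
      ε ≤ δ * (1 / (2 ^ (n + 3) * A * R ^ (n + 2))) ∧ R * ε ≤ 1 := by
  set a := Real.exp (-(n + 2 : ℕ)) with ha
  set s := h * ρ / R with hs
  set y := 1 / (2 ^ (n + 3) * A * R ^ (n + 2)) with hy
  have ha0 : 0 < a := Real.exp_pos _
  have ha1 : a ≤ 1 := Real.exp_le_one_iff.2 (neg_nonpos.2 (Nat.cast_nonneg _))
  have hs0 : 0 < s := by positivity
  have hs1 : s ≤ 1 := div_le_one_of_le₀ hR hR0.le
  have hy0 : 0 < y := by positivity
  have hy1 : y ≤ 1 := by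
    rw [hy, div_le_one₀ (by positivity)]; exact hmass
  have hZ : Real.exp (-(n + 2 : ℕ)) / 2 ^ (n + 3) * h * (h * ρ * (1 / R)) * δ *
      (1 / A) * (1 / R) ^ (n + 2) = a * h * s * (δ * y) := by
    rw [hs, hy, ha, one_div_pow]
    field_simp
  rw [hZ] at hεp
  set b := δ * y with hb
  have hb0 : 0 < b := by positivity
  have hb1 : b ≤ 1 := mul_le_one₀ (by linarith) hy0.le hy1
  have hh1 : h ≤ 1 := by linarith
  set Z := a * h * s * b with hZdef
  have hZ0 : 0 < Z := by positivity
  have hah : a * h ≤ 1 := mul_le_one₀ ha1 hh.le hh1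
  have hahs : a * h * s ≤ 1 := mul_le_one₀ hah hs0.le hs1
  have hZb : Z ≤ b := mul_le_of_le_one_left hb0.le hahs
  have hZahs : Z ≤ a * h * s := mul_le_of_le_one_right (by positivity) hb1
  have hZs : Z ≤ s := hZahs.trans (mul_le_of_le_one_left hs0.le hah)
  have hZah : Z ≤ a * h := hZahs.trans (mul_le_of_le_one_right (by positivity) hs1)
  have hZh : Z ≤ h := hZah.trans (mul_le_of_le_one_left hh.le ha1)
  have hZa : Z ≤ a := hZah.trans (mul_le_of_le_one_right ha0.le hh1)
  have hRε : R * ε < h * Z ^ 2 := by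
    have h1 : R * ε < R * (1 / R * h * Z ^ 2) := mul_lt_mul_of_pos_left hεp hR0
    rwa [show R * (1 / R * h * Z ^ 2) = h * Z ^ 2 by field_simp] at h1
  -- The polynomial controls only `R * ε`. With `h * ε < R` it gives `h * ε ^ 2 < R * ε < h * Z ^
  -- 2`, which is why the bound contains a square.
  have hεZ : ε ≤ Z := by
    rw [lt_div_iff₀ hh] at hεR
    have h2 : h * ε ^ 2 < h * Z ^ 2 := by nlinarith
    exact le_of_sq_le_sq (lt_of_mul_lt_mul_left h2 hh.le).le hZ0.le
  refine ⟨hεZ.trans hZa, hεZ.trans hZh, hεZ.trans hZs, hεZ.trans hZb, hRε.le.trans ?_⟩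
  exact mul_le_one₀ hh1 (by positivity) (pow_le_one₀ hZ0.le (hZh.trans hh1))

theorem theorem1 :
    ∃ p : Polynomial ℝ, ∀ n : ℕ, ∃ p' : MvPolynomial (Fin 8) ℝ,
      (∀ x : Fin 8 → ℝ, (∀ i, 0 < x i) → 0 < MvPolynomial.eval x p') ∧
      ∀ (lam : Fin (n + 2) → ℝ), Antitone lam → lam 1 < lam 0 → 0 < lam (Fin.last (n + 1)) →
      ∀ (ρ η δ : ℝ), 0 < ρ → 0 < η → η < 1 / (2 * lam 0) → 0 < δ →
      ∀ (A R q : ℝ), η * ρ * lam 0 < R → 0 < q →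
      ∀ (μ : Measure (EuclideanSpace ℝ (Fin (n + 2)))), IsProbabilityMeasure μ →
        HasDensityAtMost μ A →
        ENNReal.ofReal (1 - δ) ≤ μ {w₀ | ‖w₀‖ ≤ R ∧ q ≤ w₀ 0 ^ 2} →
      ∀ ε : ℝ, 0 < ε →
        ε < MvPolynomial.eval
          ![1 / lam 0, lam (Fin.last (n + 1)), η, ρ, δ, 1 / ρ, 1 / A, 1 / R] p' →
        ENNReal.ofReal (1 - 2 * δ) ≤
          μ {w₀ | ∀ t : ℕ, timeFactor lam η * p.eval (Real.log (1 / ε)) ≤ (t : ℝ) →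
            (‖samIter (quadLoss lam) η ρ w₀ t - cyclePoint lam η ρ‖ ≤ ε ∧
              ‖samIter (quadLoss lam) η ρ w₀ (t + 1) + cyclePoint lam η ρ‖ ≤ ε) ∨
            (‖samIter (quadLoss lam) η ρ w₀ t + cyclePoint lam η ρ‖ ≤ ε ∧
              ‖samIter (quadLoss lam) η ρ w₀ (t + 1) - cyclePoint lam η ρ‖ ≤ ε)} := by
  refine ⟨Polynomial.C 100 * Polynomial.X ^ 3, fun n => ⟨toleranceBound n,
    fun x hx => toleranceBound_pos n hx, ?_⟩⟩
  intro lam hlam hgap hd ρ η δ hρ hη hη2 hδ A R q hR _ μ hμ hdens hprob ε hε hεp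
  rcases lt_or_ge (1 / 2) δ with hδ2 | hδ2
  · rw [ENNReal.ofReal_of_nonpos (by linarith)]
    exact zero_le
  have H := normalizedSpectrum_of_antitone hlam hgap hd hη hη2
  have h0 : 0 < lam 0 := hd.trans_le (hlam (Fin.le_last 0))
  have hs : 0 < η * ρ * lam 0 := by positivity
  have hR0 : 0 < R := hs.trans hR
  have hhe : η * lam 0 * (lam (Fin.last (n + 1)) / lam 0) = η * lam (Fin.last (n + 1)) := by
    field_simp
  have hh0 : 0 < η * lam (Fin.last (n + 1)) := by positivity
  have hhalf := H.mul_lt_half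
  rw [hhe] at hhalf
  have hball : ENNReal.ofReal (1 - δ) ≤ μ {w₀ | ‖w₀‖ ≤ R} :=
    hprob.trans (measure_mono fun w hw => hw.1)
  -- For such a large tolerance the whole orbit is close enough. Excluding this case supplies the
  -- relation between `ε` and `R` needed when `R` is small.
  rcases le_or_gt (R / (η * lam (Fin.last (n + 1)))) ε with hεR | hεR
  · refine (ENNReal.ofReal_le_ofReal (by linarith)).trans (hball.trans (measure_mono ?_))
    intro w hw t _
    have hb := fun t c => norm_samIter_add_le hlam hd hη hρ H hR hεR hw t (c := c)
    left
    constructor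
    · simpa [sub_eq_add_neg] using hb t (-1) (by simp)
    · simpa using hb (t + 1) 1 (by simp)
  have hA := hdens.pos
  -- The ball has probability at least `1 / 2` and lies in a cube of side `2 * R`.
  have hmass : 1 ≤ 2 ^ (n + 3) * A * R ^ (n + 2) := by
    have h1 := hball.trans ((hdens.measure_le _).trans
      (mul_le_mul_right (volume_closedBall_le (n := n) hR0.le) _))
    rw [← ENNReal.ofReal_mul hA.le, ENNReal.ofReal_le_ofReal_iff (by positivity), mul_pow] at h1
    rw [pow_succ (2 : ℝ) (n + 2)]
    linarith
  have hhR : η * lam (Fin.last (n + 1)) * ρ ≤ η * ρ * lam 0 := by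
    have := mul_le_mul_of_nonneg_left (hlam (Fin.le_last 0)) (mul_pos hη hρ).le
    linarith
  obtain ⟨f1, f2, f3, f4, f5⟩ := tolerance_facts hε hh0 hhalf hρ (hhR.trans hR.le) hR0 hδ hδ2 hA
    hmass hεR (by simpa [toleranceBound] using hεp)
  set x := Real.log (1 / ε) with hx
  have hεx : ε = Real.exp (-x) := by
    rw [hx, one_div, Real.log_inv, neg_neg, Real.exp_log hε]
  -- The dimension is absorbed into `log (1 / ε)`, so one polynomial `p` serves all dimensions.
  have hxn : ((n + 2 : ℕ) : ℝ) ≤ x := by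
    rw [hεx, Real.exp_le_exp] at f1
    linarith
  have hx2 : 2 ≤ x := le_trans (by push_cast; linarith [(Nat.cast_nonneg n : (0 : ℝ) ≤ n)]) hxn
  have hexp : Real.exp x = 1 / ε := by rw [hεx, Real.exp_neg, one_div, inv_inv]
  have hRx : R ≤ Real.exp x := by rw [hexp, le_div_iff₀ hε]; exact f5
  have hRs : R / (η * ρ * lam 0) ≤ Real.exp x := by
    rw [le_div_iff₀ hR0] at f3
    rw [hexp, div_le_div_iff₀ hs hε]
    linarith
  rw [hεx] at f2 f4
  set T := ⌈x / (η * lam (Fin.last (n + 1)))⌉₊ with hT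
  have hT0 : 0 < T := Nat.ceil_pos.2 (by positivity)
  have hexc := measure_exceptional_le hlam hgap hd hη hη2 hρ hx2 hxn f2 hR hδ hdens f4 hT0
  rw [show 1 - 2 * δ = (1 - δ) - δ by ring, ENNReal.ofReal_sub _ hδ.le, tsub_le_iff_right]
  refine hball.trans ((measure_mono ?_).trans ((measure_union_le _ _).trans
    (add_le_add le_rfl hexc)))
  intro w hw
  by_cases hw' : w ∈ ({w | ‖w‖ ≤ R ∧ |w 0| ≤ R * Real.exp (-x)} ∪ ⋃ t ∈ Finset.range T,
      {w | gradChart lam η ρ w ∈ NormalizedSpectrum.resonantSet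
        (fun i => lam i / lam 0) (η * lam 0) (lam (Fin.last (n + 1)) / lam 0)
        (Real.exp (-(4 * x ^ 2 * (T + 1)))) t} : Set (EuclideanSpace ℝ (Fin (n + 2))))
  · exact Or.inr hw'
  left
  intro t ht
  have hw0 : R * Real.exp (-x) ≤ |w 0| := by
    by_contra hc
    exact hw' (Or.inl ⟨hw, (not_le.1 hc).le⟩)
  have hres : ∀ t < T, gradChart lam η ρ w ∉ NormalizedSpectrum.resonantSet
      (fun i => lam i / lam 0) (η * lam 0) (lam (Fin.last (n + 1)) / lam 0)
      (Real.exp (-(4 * x ^ 2 * (T + 1)))) t := fun t ht hc =>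
    hw' (Or.inr (Set.mem_biUnion (Finset.mem_coe.2 (Finset.mem_range.2 ht)) hc))
  have := samIter_near_cycle hlam hgap hd hη hη2 hρ hx2 hxn f2 hR hRx hRs hw hw0 hT hres
    (t := t) (by simpa using ht)
  rwa [← hεx] at this
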